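/- Let $N\ge 1$ and consider $\mathbb R^{2N-1}$ with coordinates $(a_1,\dots,a_{N-1},b_1,\dots,b_N)$; put $a_n=0$ for $n\notin\{1,\dots,N-1\}$ and $b_n=0$ for $n\notin\{1,\dots,N\}$. Let $L$ be the symmetric tridiagonal $N\times N$ matrix with diagonal $b_1,\dots,b_N$ and off-diagonal entries $a_1,\dots,a_{N-1}$, and let $H_l=\frac1l\operatorname{tr}L^l$ for $l\ge 1$. The linear, quadratic and cubic Toda brackets are the skew-symmetric contravariant 2-tensors whose only nonzero brackets of coordinates, up to skew-symmetry, are: - $\pi_1$: $\{a_i,b_i\}=-a_i$, $\{a_i,b_{i+1}\}=a_i$; - $\pi_2$: $\{a_i,a_{i+1}\}=\frac12a_ia_{i+1}$, $\{a_i,b_i\}=-a_ib_i$, $\{a_i,b_{i+1}\}=a_ib_{i+1}$, $\{b_i,b_{i+1}\}=2a_i^2$; - $\pi_3$: $\{a_i,a_{i+1}\}=a_ia_{i+1}b_{i+1}$, $\{a_i,b_i\}=-a_ib_i^2-a_i^3$, $\{a_i,b_{i+1}\}=a_ib_{i+1}^2+a_i^3$, $\{a_i,b_{i+2}\}=a_ia_{i+1}^2$,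 $\{a_{i+1},b_i\}=-a_i^2a_{i+1}$, $\{b_i,b_{i+1}\}=2a_i^2(b_i+b_{i+1})$. Let $X_1$ be the vector field defined by the equation $\dot L=[B,L]+L^2$, where $B$ is skew-symmetric and tridiagonal with $B_{n,n+1}=(n+1)a_n$. Let $X_2$ be the one defined by $\dot L=[B,L]+L^3$, where $B$ is skew-symmetric and pentadiagonal with $B_{n,n+1}=a_n\big(n(b_n+b_{n+1})+\sum_{i<n}b_i\big)$ and $B_{n,n+2}=n\,a_na_{n+1}$. For $n\ge 3$ define $X_n$ by $[X_1,X_{n-1}]=(n-2)X_n$. Call two contravariant 2-tensors $P,Q$ equivalent if $(P-Q)\nabla H_l=0$ for all $l\ge1$. A Toda hierarchy is a sequence $\pi_1,\pi_2,\pi_3,\pi_4,\dots$ of smooth skew-symmetric contravariant 2-tensors on $\mathbb R^{2N-1}$, beginning with the three tensors above, such that each $\pi_n$ with $n\ge4$ is generated from an earlier tensor by a master symmetry: there are $k,m\ge1$ with $k+m=n$ and $m\ne k+2$ such that $L_{X_k}\pi_m$ is equivalent to $(m-k-2)\,\pi_n$. Then Toda hierarchies exist, and for every Toda hierarchy the Lenard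 relations hold: with $\chi_l^n=\pi_n\nabla H_l$ the Hamiltonian vector field of $H_l$ with respect to $\pi_n$, $$\chi_l^{n+1}=\chi_{l+1}^n,\qquad\text{i.e.}\qquad \pi_{n+1}\nabla H_l=\pi_n\nabla H_{l+1},\qquad\text{for all } n\ge1,\ l\ge1.$$ -/

import Mathlib

open scoped ContDiff

noncomputable section

/-- Index set of the coordinates `(a₁, …, a_{N-1}, b₁, …, b_N)` of `ℝ^{2N-1}`. -/
abbrev TodaIndex (N : ℕ) : Type := Fin (N - 1) ⊕ Fin N

/-- The phase space `ℝ^{2N-1}` of the finite nonperiodic Toda lattice in Flaschka variables. -/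
abbrev TodaSpace (N : ℕ) : Type := TodaIndex N → ℝ

/-- The coordinate `aₙ` (numbered from 1), with `aₙ = 0` unless `1 ≤ n ≤ N - 1`. -/
def coordA {N : ℕ} (x : TodaSpace N) (n : ℕ) : ℝ :=
  if h : 1 ≤ n ∧ n ≤ N - 1 then x (Sum.inl ⟨n - 1, by omega⟩) else 0

/-- The coordinate `bₙ` (numbered from 1), with `bₙ = 0` unless `1 ≤ n ≤ N`. -/
def coordB {N : ℕ} (x : TodaSpace N) (n : ℕ) : ℝ :=
  if h : 1 ≤ n ∧ n ≤ N then x (Sum.inr ⟨n - 1, by omega⟩) else 0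

/-- The Jacobi matrix `L`: symmetric tridiagonal, with diagonal `b₁, …, b_N` and off-diagonal
entries `a₁, …, a_{N-1}`. -/
def jacobiMatrix {N : ℕ} (x : TodaSpace N) : Matrix (Fin N) (Fin N) ℝ :=
  Matrix.of fun i j =>
    if j.val = i.val then coordB x (i.val + 1)
    else if j.val = i.val + 1 then coordA x (i.val + 1)
    else if i.val = j.val + 1 then coordA x (j.val + 1)
    else 0

/-- The constants of motion `H_l = (1 / l) tr L^l`, for `l ≥ 1`. -/
def todaH (N l : ℕ) (x : TodaSpace N) : ℝ :=
  1 / (l : ℝ) * ((jacobiMatrix x) ^ l).trace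

/-- The gradient `∇f = (∂f/∂a₁, …, ∂f/∂b_N)`. -/
def coordGrad {N : ℕ} (f : TodaSpace N → ℝ) (x : TodaSpace N) : TodaSpace N :=
  fun i => fderiv ℝ f x (Pi.single i 1)

/-- A contravariant 2-tensor field on `ℝ^{2N-1}`, given by its matrix of components: the entry
`(i, j)` is the bracket of the `i`-th and the `j`-th coordinate. -/
abbrev TodaTensor (N : ℕ) : Type := TodaSpace N → Matrix (TodaIndex N) (TodaIndex N) ℝ

/-- The Hamiltonian vector field `P ∇f` of `f` with respect to the tensor `P`. -/
def hamiltonianField {N : ℕ} (P : TodaTensor N) (f : TodaSpace N → ℝ) :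
    TodaSpace N → TodaSpace N :=
  fun x => (P x).mulVec (coordGrad f x)

/-- The Lie derivative `L_X P` of a contravariant 2-tensor field along a vector field:
`(L_X P)^{ij} = ∑ₖ (X^k ∂ₖ P^{ij} - ∂ₖ X^i P^{kj} - ∂ₖ X^j P^{ik})`. -/
def lieDerivTensor {N : ℕ} (X : TodaSpace N → TodaSpace N) (P : TodaTensor N) : TodaTensor N :=
  fun x => Matrix.of fun i j =>
    ∑ k, (X x k * coordGrad (fun y => P y i j) x k
      - coordGrad (fun y => X y i) x k * P x k j
      - coordGrad (fun y => X y j) x k * P x i k)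

/-- The skew-symmetric matrix with `{a_p, a_q} = u p q - u q p`, `{a_p, b_q} = v p q`,
`{b_p, b_q} = w p q - w q p` (indices numbered from 1). -/
def skewOfBrackets (N : ℕ) (u v w : ℕ → ℕ → ℝ) : Matrix (TodaIndex N) (TodaIndex N) ℝ :=
  Matrix.fromBlocks
    (Matrix.of fun i j => u (i.val + 1) (j.val + 1) - u (j.val + 1) (i.val + 1))
    (Matrix.of fun i j => v (i.val + 1) (j.val + 1))
    (Matrix.of fun j i => - v (i.val + 1) (j.val + 1))
    (Matrix.of fun i j => w (i.val + 1) (j.val + 1) - w (j.val + 1) (i.val + 1))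

/-- The linear (Lie-Poisson) Toda bracket `π₁`. -/
def linearToda (N : ℕ) : TodaTensor N := fun x =>
  skewOfBrackets N
    (fun _ _ => 0)
    (fun p q =>
      if q = p then - coordA x p
      else if q = p + 1 then coordA x p
      else 0)
    (fun _ _ => 0)

/-- The quadratic Toda bracket `π₂`. -/
def quadraticToda (N : ℕ) : TodaTensor N := fun x =>
  skewOfBrackets N
    (fun p q => if q = p + 1 then 1 / 2 * coordA x p * coordA x (p + 1) else 0)
    (fun p q =>
      if q = p then - coordA x p * coordB x p
      else if q = p + 1 then coordA x p * coordB x (p + 1)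
      else 0)
    (fun p q => if q = p + 1 then 2 * coordA x p ^ 2 else 0)

/-- The cubic Toda bracket `π₃`. -/
def cubicToda (N : ℕ) : TodaTensor N := fun x =>
  skewOfBrackets N
    (fun p q => if q = p + 1 then coordA x p * coordA x (p + 1) * coordB x (p + 1) else 0)
    (fun p q =>
      if q = p then - coordA x p * coordB x p ^ 2 - coordA x p ^ 3
      else if q = p + 1 then coordA x p * coordB x (p + 1) ^ 2 + coordA x p ^ 3
      else if q = p + 2 then coordA x p * coordA x (p + 1) ^ 2
      else if p = q + 1 then - coordA x q ^ 2 * coordA x (q + 1)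
      else 0)
    (fun p q => if q = p + 1 then 2 * coordA x p ^ 2 * (coordB x p + coordB x (p + 1)) else 0)

/-- The vector field with components `α x n` along `∂/∂aₙ` and `β x n` along `∂/∂bₙ`
(indices numbered from 1). -/
def fieldOfComponents {N : ℕ} (α β : TodaSpace N → ℕ → ℝ) : TodaSpace N → TodaSpace N :=
  fun x => Sum.elim (fun i => α x (i.val + 1)) (fun i => β x (i.val + 1))

/-- The master symmetry `X₁`, the vector field of the equation `L' = [B, L] + L²`, where `B` is
skew-symmetric and tridiagonal with `B_{n,n+1} = (n + 1) aₙ`. -/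
def masterOne (N : ℕ) : TodaSpace N → TodaSpace N :=
  fieldOfComponents
    (fun x n => - (n : ℝ) * coordA x n * coordB x n + (n + 2) * coordA x n * coordB x (n + 1))
    (fun x n => (2 * n + 3) * coordA x n ^ 2 + (1 - 2 * n) * coordA x (n - 1) ^ 2
      + coordB x n ^ 2)

/-- The partial sum `σₙ = b₁ + ⋯ + b_{n-1}`. -/
def sigmaB {N : ℕ} (x : TodaSpace N) (n : ℕ) : ℝ := ∑ i ∈ Finset.Ico 1 n, coordB x i

/-- The master symmetry `X₂`, the vector field of the equation `L' = [B, L] + L³`, where `B` is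
skew-symmetric and pentadiagonal with `B_{n,n+1} = aₙ (n (bₙ + b_{n+1}) + σₙ)` and
`B_{n,n+2} = n aₙ a_{n+1}`. -/
def masterTwo (N : ℕ) : TodaSpace N → TodaSpace N :=
  fieldOfComponents
    (fun x n =>
      (2 - n) * coordA x (n - 1) ^ 2 * coordA x n + (1 - n) * coordA x n * coordB x n ^ 2
      + coordA x n * coordB x n * coordB x (n + 1)
      + (n + 1) * coordA x n * coordA x (n + 1) ^ 2
      + (n + 1) * coordA x n * coordB x (n + 1) ^ 2 + coordA x n ^ 3
      + sigmaB x n * coordA x n * (coordB x (n + 1) - coordB x n))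
    (fun x n =>
      2 * sigmaB x n * coordA x n ^ 2 - 2 * sigmaB x (n - 1) * coordA x (n - 1) ^ 2
      + (2 * n + 2) * coordA x n ^ 2 * coordB x n
      + (2 * n + 1) * coordA x n ^ 2 * coordB x (n + 1)
      + (3 - 2 * n) * coordA x (n - 1) ^ 2 * coordB x (n - 1)
      + (4 - 2 * n) * coordA x (n - 1) ^ 2 * coordB x n + coordB x n ^ 3)

/-- The master symmetries `Xₙ`, `n ≥ 0`: `X₀` is the Euler vector field, `X₁` and `X₂` are as
above, and `[X₁, X_{n-1}] = (n - 2) Xₙ` for `n ≥ 3`. -/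
def masterSymmetry (N : ℕ) : ℕ → TodaSpace N → TodaSpace N
  | 0 => id
  | 1 => masterOne N
  | 2 => masterTwo N
  | n + 3 => ((1 : ℝ) / ((n : ℝ) + 1)) •
      VectorField.lieBracket ℝ (masterOne N) (masterSymmetry N (n + 2))

/-- Two tensors are equivalent if all `H_l`, `l ≥ 1`, are Casimirs of their difference. -/
def TensorEquiv {N : ℕ} (P Q : TodaTensor N) : Prop :=
  ∀ l : ℕ, 1 ≤ l → ∀ x, hamiltonianField (P - Q) (todaH N l) x = 0

/-- A Toda hierarchy `π₁, π₂, …` generated by the master symmetries: smooth skew-symmetric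
contravariant 2-tensors, beginning with the linear, the quadratic and the cubic Toda bracket, where
each later `πₙ` is obtained from an earlier `π_m` by a master symmetry `X_k` through
`L_{X_k} π_m = (m - k - 2) π_{k+m}` with nonzero factor, up to equivalence. The value at `0` is
irrelevant. -/
structure IsTodaHierarchy (N : ℕ) (π : ℕ → TodaTensor N) : Prop where
  smooth : ∀ n, 1 ≤ n → ∀ i j, ContDiff ℝ ∞ (fun x => π n x i j)
  skew : ∀ n, 1 ≤ n → ∀ x, (π n x).transpose = - π n x
  one : π 1 = linearToda N
  two : π 2 = quadraticToda N
  three : π 3 = cubicToda N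
  generated : ∀ n, 4 ≤ n → ∃ k m : ℕ, 1 ≤ k ∧ 1 ≤ m ∧ k + m = n ∧ m ≠ k + 2 ∧
    TensorEquiv (lieDerivTensor (masterSymmetry N k) (π m)) (((m : ℝ) - k - 2) • π n)

end

/-! Everything is measured against one family of isospectral vector fields: `chi N m` is the flow
with Lax equation L' = [Π(L^m), L], where Π M is the strictly upper part of M minus its strictly
lower part. The claim behind the Lenard relations is π_n ∇H_l = `chi N (l + n - 2)` for all n, l ≥
1; the right side depends only on l + n.

For n ≤ 3 this is a computation. The gradient of H_l is read off from M = L^(l-1), and on the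
gradient vector of a symmetric M commuting with L, π₂ and π₃ act as π₁ does with M replaced by LM
and L²M (`linearToda_mulVec`, `quadraticToda_mulVec`, `cubicToda_mulVec`).

For n ≥ 4 the Leibniz rule (L_X P)∇f = [X, P∇f] − P∇(X f) is applied with X = X_k, P = π_s and f =
H_l. It needs X_k H_l = (l + k) H_{l+k} (`fderiv_todaH_masterSymmetry`) and [X_k, `chi m`] = m `chi
(m + k)` (`lieBracket_masterSymmetry_chi`). With m = l + s − 2, both terms are multiples of the same
flow, with total factor (l + s − 2) − (l + k) = s − k − 2, which is exactly the factor in front of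
π_{k+s}. It is nonzero, so it can be divided out.

Both facts about X_k are proved for X₁ and X₂ from their Lax equations and passed on to X₃, X₄, …
through [X₁, ·]. For the flows the crux is a compatibility of B with Π
(`skewPart_commutator_skewBand`). Existence follows by generating every π_n, n ≥ 4, directly from
π₁. -/

open scoped ContDiff

noncomputable section

/-! ### Matrix entries numbered from 1 and extended by zero; band matrices; the isospectral flow. -/

section Entries

variable {N : ℕ}

/-- The entries of a square matrix, numbered from 1 and extended by zero. -/
def entry (M : Matrix (Fin N) (Fin N) ℝ) (p q : ℕ) : ℝ :=
  if h : (1 ≤ p ∧ p ≤ N) ∧ (1 ≤ q ∧ q ≤ N) then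
    M ⟨p - 1, by omega⟩ ⟨q - 1, by omega⟩ else 0

lemma entry_succ (M : Matrix (Fin N) (Fin N) ℝ) (i j : Fin N) :
    entry M (i.val + 1) (j.val + 1) = M i j := by
  have hi := i.isLt
  have hj := j.isLt
  rw [entry, dif_pos (by omega)]
  rfl

lemma entry_eq_zero (M : Matrix (Fin N) (Fin N) ℝ) {p q : ℕ}
    (h : ¬ ((1 ≤ p ∧ p ≤ N) ∧ (1 ≤ q ∧ q ≤ N))) : entry M p q = 0 := dif_neg h

@[simp] lemma entry_zero_left (M : Matrix (Fin N) (Fin N) ℝ) (q : ℕ) : entry M 0 q = 0 :=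
  entry_eq_zero M (by omega)

@[simp] lemma entry_zero_right (M : Matrix (Fin N) (Fin N) ℝ) (p : ℕ) : entry M p 0 = 0 :=
  entry_eq_zero M (by omega)

lemma entry_ext {A B : Matrix (Fin N) (Fin N) ℝ}
    (h : ∀ p q, p + 1 ≤ N → q + 1 ≤ N → entry A (p + 1) (q + 1) = entry B (p + 1) (q + 1)) :
    A = B := by
  ext i j
  rw [← entry_succ A, ← entry_succ B]
  exact h _ _ i.isLt j.isLt

lemma entry_of (f : ℕ → ℕ → ℝ) {p q : ℕ} (hp : 1 ≤ p ∧ p ≤ N) (hq : 1 ≤ q ∧ q ≤ N) :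
    entry (Matrix.of fun i j : Fin N => f (i.val + 1) (j.val + 1)) p q = f p q := by
  rw [entry, dif_pos ⟨hp, hq⟩]
  simp only [Matrix.of_apply]
  congr 1 <;> omega

@[simp] lemma entry_add (A B : Matrix (Fin N) (Fin N) ℝ) (p q : ℕ) :
    entry (A + B) p q = entry A p q + entry B p q := by
  unfold entry; split_ifs <;> simp

@[simp] lemma entry_sub (A B : Matrix (Fin N) (Fin N) ℝ) (p q : ℕ) :
    entry (A - B) p q = entry A p q - entry B p q := by
  unfold entry; split_ifs <;> simp

@[simp] lemma entry_neg (A : Matrix (Fin N) (Fin N) ℝ) (p q : ℕ) :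
    entry (-A) p q = - entry A p q := by
  unfold entry; split_ifs <;> simp

lemma entry_transpose (A : Matrix (Fin N) (Fin N) ℝ) (p q : ℕ) :
    entry A.transpose p q = entry A q p := by
  unfold entry
  by_cases h : (1 ≤ p ∧ p ≤ N) ∧ (1 ≤ q ∧ q ≤ N)
  · rw [dif_pos h, dif_pos h.symm]; rfl
  · rw [dif_neg h, dif_neg (fun h' => h h'.symm)]

lemma entry_comm {A : Matrix (Fin N) (Fin N) ℝ} (hA : A.transpose = A) (p q : ℕ) :
    entry A p q = entry A q p := by
  rw [← entry_transpose, hA]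

lemma sum_fin_succ_eq_sum_Icc (n : ℕ) (f : ℕ → ℝ) :
    ∑ i : Fin n, f (i.val + 1) = ∑ p ∈ Finset.Icc 1 n, f p := by
  rw [Fin.sum_univ_eq_sum_range (fun r => f (r + 1)), Finset.range_eq_Ico,
    Finset.sum_Ico_add' f 0 n 1]
  rfl

lemma entry_mul (A B : Matrix (Fin N) (Fin N) ℝ) (p q : ℕ) :
    entry (A * B) p q = ∑ r ∈ Finset.Icc 1 N, entry A p r * entry B r q := by
  rw [← sum_fin_succ_eq_sum_Icc]
  by_cases h : (1 ≤ p ∧ p ≤ N) ∧ (1 ≤ q ∧ q ≤ N)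
  · obtain ⟨i, rfl⟩ : ∃ i : Fin N, p = i.val + 1 := ⟨⟨p - 1, by omega⟩, by simp; omega⟩
    obtain ⟨j, rfl⟩ : ∃ j : Fin N, q = j.val + 1 := ⟨⟨q - 1, by omega⟩, by simp; omega⟩
    simp only [entry_succ, Matrix.mul_apply]
  · rw [entry_eq_zero _ h]
    symm
    apply Finset.sum_eq_zero
    intro r _
    by_cases hp : 1 ≤ p ∧ p ≤ N
    · rw [entry_eq_zero B (fun h' => h ⟨hp, h'.2⟩), mul_zero]
    · rw [entry_eq_zero A (fun h' => hp h'.1), zero_mul]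

lemma trace_eq_sum_entry (A : Matrix (Fin N) (Fin N) ℝ) :
    A.trace = ∑ p ∈ Finset.Icc 1 N, entry A p p := by
  rw [← sum_fin_succ_eq_sum_Icc]
  simp only [entry_succ, Matrix.trace, Matrix.diag_apply]

lemma coordA_eq_zero (x : TodaSpace N) {n : ℕ} (h : ¬ (1 ≤ n ∧ n ≤ N - 1)) : coordA x n = 0 :=
  dif_neg h

lemma coordB_eq_zero (x : TodaSpace N) {n : ℕ} (h : ¬ (1 ≤ n ∧ n ≤ N)) : coordB x n = 0 :=
  dif_neg h

@[simp] lemma coordA_zero (x : TodaSpace N) : coordA x 0 = 0 := coordA_eq_zero x (by omega)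

lemma coordA_succ (x : TodaSpace N) (i : Fin (N - 1)) : coordA x (i.val + 1) = x (Sum.inl i) := by
  have := i.isLt
  rw [coordA, dif_pos (by omega)]; rfl

lemma coordB_succ (x : TodaSpace N) (i : Fin N) : coordB x (i.val + 1) = x (Sum.inr i) := by
  have := i.isLt
  rw [coordB, dif_pos (by omega)]; rfl

lemma todaSpace_ext {x y : TodaSpace N}
    (hA : ∀ p, p + 1 ≤ N - 1 → coordA x (p + 1) = coordA y (p + 1))
    (hB : ∀ p, p + 1 ≤ N → coordB x (p + 1) = coordB y (p + 1)) : x = y := by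
  ext i
  rcases i with i | i
  · rw [← coordA_succ x, ← coordA_succ y]; exact hA _ i.isLt
  · rw [← coordB_succ x, ← coordB_succ y]; exact hB _ i.isLt

lemma entry_jacobiMatrix (x : TodaSpace N) (p q : ℕ) :
    entry (jacobiMatrix x) p q = (if q = p then coordB x p else 0)
      + (if q = p + 1 then coordA x p else 0) + (if p = q + 1 then coordA x q else 0) := by
  by_cases h : (1 ≤ p ∧ p ≤ N) ∧ (1 ≤ q ∧ q ≤ N)
  · obtain ⟨i, rfl⟩ : ∃ i : Fin N, p = i.val + 1 := ⟨⟨p - 1, by omega⟩, by simp; omega⟩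
    obtain ⟨j, rfl⟩ : ∃ j : Fin N, q = j.val + 1 := ⟨⟨q - 1, by omega⟩, by simp; omega⟩
    rw [entry_succ]
    simp only [jacobiMatrix, Matrix.of_apply]
    split_ifs <;> first | omega | simp
  · rw [entry_eq_zero _ h]
    split_ifs <;> first | omega | skip
    · rw [coordB_eq_zero x (by omega)]; simp
    · rw [coordA_eq_zero x (by omega)]; simp
    · rw [coordA_eq_zero x (by omega)]; simp
    · simp

lemma jacobiMatrix_transpose (x : TodaSpace N) : (jacobiMatrix x).transpose = jacobiMatrix x := by
  apply entry_ext
  intro p q _ _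
  rw [entry_transpose, entry_jacobiMatrix, entry_jacobiMatrix]
  rcases eq_or_ne p q with rfl | h
  · simp
  · rw [if_neg (show ¬ p + 1 = q + 1 by omega), if_neg (show ¬ q + 1 = p + 1 by omega)]
    ring

lemma jacobiMatrix_pow_transpose (x : TodaSpace N) (m : ℕ) :
    (jacobiMatrix x ^ m).transpose = jacobiMatrix x ^ m := by
  rw [Matrix.transpose_pow, jacobiMatrix_transpose]

/-- No range condition on p is needed: terms that leave the matrix carry a coordinate equal to zero.
Writing the row as p + 1 keeps truncated subtraction out. -/
lemma entry_jacobiMatrix_mul (x : TodaSpace N) (M : Matrix (Fin N) (Fin N) ℝ) (p q : ℕ) :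
    entry (jacobiMatrix x * M) (p + 1) q = coordA x p * entry M p q
      + coordB x (p + 1) * entry M (p + 1) q + coordA x (p + 1) * entry M (p + 2) q := by
  rw [entry_mul]
  simp only [entry_jacobiMatrix, add_mul, Finset.sum_add_distrib, ite_mul, zero_mul,
    Finset.sum_ite_eq', Finset.mem_Icc, add_left_inj, Finset.sum_ite_eq]
  have e1 : (if 1 ≤ p + 1 ∧ p + 1 ≤ N then coordB x (p + 1) * entry M (p + 1) q else 0)
      = coordB x (p + 1) * entry M (p + 1) q := by
    split_ifs with h
    · rfl
    · rw [coordB_eq_zero x h, zero_mul]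
  have e2 : (if 1 ≤ p + 1 + 1 ∧ p + 1 + 1 ≤ N then coordA x (p + 1) * entry M (p + 1 + 1) q else 0)
      = coordA x (p + 1) * entry M (p + 1 + 1) q := by
    split_ifs with h
    · rfl
    · rw [coordA_eq_zero x (by omega), zero_mul]
  have e3 : (if 1 ≤ p ∧ p ≤ N then coordA x p * entry M p q else 0)
      = coordA x p * entry M p q := by
    split_ifs with h
    · rfl
    · rw [coordA_eq_zero x (by omega), zero_mul]
  rw [e1, e2, e3]
  ring

lemma entry_mul_jacobiMatrix (x : TodaSpace N) (M : Matrix (Fin N) (Fin N) ℝ) (p q : ℕ) :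
    entry (M * jacobiMatrix x) p (q + 1) = coordA x q * entry M p q
      + coordB x (q + 1) * entry M p (q + 1) + coordA x (q + 1) * entry M p (q + 2) := by
  rw [← entry_transpose, Matrix.transpose_mul, jacobiMatrix_transpose, entry_jacobiMatrix_mul]
  simp only [entry_transpose]

/-- This allows identities between vector fields to be checked as identities between matrices. -/
lemma eq_of_jacobiMatrix_eq {x y : TodaSpace N} (h : jacobiMatrix x = jacobiMatrix y) : x = y := by
  apply todaSpace_ext
  · intro p _
    have := congrArg (fun M => entry M (p + 1) (p + 2)) h
    simpa [entry_jacobiMatrix] using this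
  · intro p _
    have := congrArg (fun M => entry M (p + 1) (p + 1)) h
    simpa [entry_jacobiMatrix] using this

/-- The skew-symmetric pentadiagonal matrix with `B_{n,n+1} = βₙ` and `B_{n,n+2} = γₙ`. -/
def skewBand (N : ℕ) (β γ : ℕ → ℝ) : Matrix (Fin N) (Fin N) ℝ :=
  Matrix.of fun i j =>
    ((if j.val + 1 = i.val + 1 + 1 then β (i.val + 1) else 0)
      + (if j.val + 1 = i.val + 1 + 2 then γ (i.val + 1) else 0))
    - ((if i.val + 1 = j.val + 1 + 1 then β (j.val + 1) else 0)
      + (if i.val + 1 = j.val + 1 + 2 then γ (j.val + 1) else 0))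

lemma entry_skewBand (β γ : ℕ → ℝ) {p q : ℕ} (hp : 1 ≤ p ∧ p ≤ N) (hq : 1 ≤ q ∧ q ≤ N) :
    entry (skewBand N β γ) p q =
      ((if q = p + 1 then β p else 0) + (if q = p + 2 then γ p else 0))
      - ((if p = q + 1 then β q else 0) + (if p = q + 2 then γ q else 0)) :=
  entry_of (fun p q => ((if q = p + 1 then β p else 0) + (if q = p + 2 then γ p else 0))
      - ((if p = q + 1 then β q else 0) + (if p = q + 2 then γ q else 0))) hp hq

lemma skewBand_transpose (β γ : ℕ → ℝ) : (skewBand N β γ).transpose = - skewBand N β γ := by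
  ext i j
  simp [skewBand]

/-- For p ≤ 1 the truncated index `p - 1` is row 0, where `entry` vanishes, so the last term drops
out as it should. -/
lemma entry_skewBand_mul (β γ : ℕ → ℝ) (M : Matrix (Fin N) (Fin N) ℝ) {p : ℕ} (q : ℕ)
    (hp : p + 1 ≤ N) :
    entry (skewBand N β γ * M) (p + 1) q = β (p + 1) * entry M (p + 2) q
      + γ (p + 1) * entry M (p + 3) q - β p * entry M p q - γ (p - 1) * entry M (p - 1) q := by
  rw [entry_mul]
  have e0 : ∀ r ∈ Finset.Icc 1 N, entry (skewBand N β γ) (p + 1) r * entry M r q =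
      (if r = p + 2 then β (p + 1) * entry M r q else 0)
      + (if r = p + 3 then γ (p + 1) * entry M r q else 0)
      - (if r = p then β r * entry M r q else 0)
      - (if r = p - 1 then γ r * entry M r q else 0) := by
    intro r hr
    rw [Finset.mem_Icc] at hr
    rw [entry_skewBand β γ ⟨by omega, hp⟩ hr]
    split_ifs <;> first | omega | ring
  rw [Finset.sum_congr rfl e0]
  simp only [Finset.sum_add_distrib, Finset.sum_sub_distrib, Finset.sum_ite_eq', Finset.mem_Icc]
  have e : ∀ (c : ℝ) (r : ℕ), (if 1 ≤ r ∧ r ≤ N then c * entry M r q else 0) = c * entry M r q := by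
    intro c r
    split_ifs with h
    · rfl
    · rw [entry_eq_zero M (fun h' => h h'.1), mul_zero]
  simp only [e]

lemma entry_mul_skewBand (β γ : ℕ → ℝ) (M : Matrix (Fin N) (Fin N) ℝ) (p : ℕ) {q : ℕ}
    (hq : q + 1 ≤ N) :
    entry (M * skewBand N β γ) p (q + 1) = - β (q + 1) * entry M p (q + 2)
      - γ (q + 1) * entry M p (q + 3) + β q * entry M p q + γ (q - 1) * entry M p (q - 1) := by
  rw [← entry_transpose, Matrix.transpose_mul, skewBand_transpose, neg_mul, entry_neg,
    entry_skewBand_mul _ _ _ _ hq]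
  simp only [entry_transpose]
  ring

/-- The strictly upper triangular part minus the strictly lower triangular part. -/
def skewPart (M : Matrix (Fin N) (Fin N) ℝ) : Matrix (Fin N) (Fin N) ℝ :=
  Matrix.of fun i j => if i < j then M i j else if j < i then - M i j else 0

lemma entry_skewPart (M : Matrix (Fin N) (Fin N) ℝ) (p q : ℕ) :
    entry (skewPart M) p q = if p < q then entry M p q else if q < p then - entry M p q else 0 := by
  by_cases h : (1 ≤ p ∧ p ≤ N) ∧ (1 ≤ q ∧ q ≤ N)
  · obtain ⟨i, rfl⟩ : ∃ i : Fin N, p = i.val + 1 := ⟨⟨p - 1, by omega⟩, by simp; omega⟩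
    obtain ⟨j, rfl⟩ : ∃ j : Fin N, q = j.val + 1 := ⟨⟨q - 1, by omega⟩, by simp; omega⟩
    simp only [entry_succ, skewPart, Matrix.of_apply, Fin.lt_def, add_lt_add_iff_right]
  · simp [entry_eq_zero _ h]

lemma skewPart_transpose {M : Matrix (Fin N) (Fin N) ℝ} (hM : M.transpose = M) :
    (skewPart M).transpose = - skewPart M := by
  apply entry_ext
  intro p q _ _
  rw [entry_transpose, entry_neg, entry_skewPart, entry_skewPart, entry_comm hM]
  split_ifs <;> first | omega | simp

lemma skewPart_add (A B : Matrix (Fin N) (Fin N) ℝ) :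
    skewPart (A + B) = skewPart A + skewPart B := by
  ext i j; simp only [skewPart, Matrix.of_apply, Matrix.add_apply]; split_ifs <;> ring

lemma skewPart_smul (c : ℝ) (A : Matrix (Fin N) (Fin N) ℝ) :
    skewPart (c • A) = c • skewPart A := by
  ext i j; simp only [skewPart, Matrix.of_apply, Matrix.smul_apply]; split_ifs <;> simp

/-- A symmetric matrix is determined by its upper triangle. -/
lemma symm_ext {A B : Matrix (Fin N) (Fin N) ℝ} (hA : A.transpose = A) (hB : B.transpose = B)
    (h : ∀ p d, p + d + 1 ≤ N → entry A (p + 1) (p + d + 1) = entry B (p + 1) (p + d + 1)) :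
    A = B := by
  apply entry_ext
  intro p q hp hq
  rcases le_total p q with hpq | hpq
  · obtain ⟨d, rfl⟩ := Nat.exists_eq_add_of_le hpq
    exact h p d hq
  · obtain ⟨d, rfl⟩ := Nat.exists_eq_add_of_le hpq
    rw [entry_comm hA, entry_comm hB]
    exact h q d hp

/-- A skew-symmetric matrix is determined by its strictly upper triangle. -/
lemma skew_ext {A B : Matrix (Fin N) (Fin N) ℝ} (hA : A.transpose = - A) (hB : B.transpose = - B)
    (h : ∀ p d, p + d + 2 ≤ N → entry A (p + 1) (p + d + 2) = entry B (p + 1) (p + d + 2)) :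
    A = B := by
  have key : ∀ (C : Matrix (Fin N) (Fin N) ℝ), C.transpose = - C → ∀ p q,
      entry C p q = - entry C q p := by
    intro C hC p q
    rw [← entry_transpose C p q, hC, entry_neg, neg_neg]
  apply entry_ext
  intro p q hp hq
  rcases lt_trichotomy p q with hpq | rfl | hpq
  · obtain ⟨d, rfl⟩ := Nat.exists_eq_add_of_lt hpq
    exact h p d hq
  · have h1 := key A hA (p + 1) (p + 1)
    have h2 := key B hB (p + 1) (p + 1)
    linarith
  · obtain ⟨d, rfl⟩ := Nat.exists_eq_add_of_lt hpq
    rw [key A hA, key B hB]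
    exact congrArg Neg.neg (h q d hp)

lemma commutator_transpose {A S : Matrix (Fin N) (Fin N) ℝ} (hA : A.transpose = - A)
    (hS : S.transpose = S) : (A * S - S * A).transpose = A * S - S * A := by
  rw [Matrix.transpose_sub, Matrix.transpose_mul, Matrix.transpose_mul, hA, hS]
  simp only [Matrix.mul_neg, Matrix.neg_mul]
  abel

lemma commutator_transpose_of_skew {A S : Matrix (Fin N) (Fin N) ℝ} (hA : A.transpose = - A)
    (hS : S.transpose = - S) : (A * S - S * A).transpose = - (A * S - S * A) := by
  rw [Matrix.transpose_sub, Matrix.transpose_mul, Matrix.transpose_mul, hA, hS]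
  simp only [Matrix.mul_neg, Matrix.neg_mul]
  abel

lemma coordA_fieldOfComponents {α β : TodaSpace N → ℕ → ℝ} {x : TodaSpace N} {n : ℕ}
    (hα : ¬ (1 ≤ n ∧ n ≤ N - 1) → α x n = 0) :
    coordA (fieldOfComponents α β x) n = α x n := by
  by_cases h : 1 ≤ n ∧ n ≤ N - 1
  · obtain ⟨i, rfl⟩ : ∃ i : Fin (N - 1), n = i.val + 1 := ⟨⟨n - 1, by omega⟩, by simp; omega⟩
    rw [coordA_succ]; rfl
  · rw [coordA_eq_zero _ h, hα h]

lemma coordB_fieldOfComponents {α β : TodaSpace N → ℕ → ℝ} {x : TodaSpace N} {n : ℕ}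
    (hn : n + 1 ≤ N) :
    coordB (fieldOfComponents α β x) (n + 1) = β x (n + 1) :=
  coordB_succ _ (⟨n, hn⟩ : Fin N)

/-- The value at `x` of the isospectral flow of a symmetric matrix `M` commuting with `L`:
`aₚ' = aₚ (M_{p+1,p+1} - M_{p,p})`, `bₚ' = 2 aₚ M_{p,p+1} - 2 a_{p-1} M_{p-1,p}`. -/
def todaFlow (x : TodaSpace N) (M : Matrix (Fin N) (Fin N) ℝ) : TodaSpace N :=
  Sum.elim
    (fun i => coordA x (i.val + 1) * (entry M (i.val + 2) (i.val + 2)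
      - entry M (i.val + 1) (i.val + 1)))
    (fun i => 2 * coordA x (i.val + 1) * entry M (i.val + 1) (i.val + 2)
      - 2 * coordA x i.val * entry M i.val (i.val + 1))

lemma coordA_todaFlow (x : TodaSpace N) (M : Matrix (Fin N) (Fin N) ℝ) (n : ℕ) :
    coordA (todaFlow x M) n = coordA x n * (entry M (n + 1) (n + 1) - entry M n n) := by
  by_cases h : 1 ≤ n ∧ n ≤ N - 1
  · obtain ⟨i, rfl⟩ : ∃ i : Fin (N - 1), n = i.val + 1 := ⟨⟨n - 1, by omega⟩, by simp; omega⟩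
    rw [coordA_succ]; rfl
  · rw [coordA_eq_zero _ h, coordA_eq_zero _ h, zero_mul]

lemma coordB_todaFlow (x : TodaSpace N) (M : Matrix (Fin N) (Fin N) ℝ) (n : ℕ) :
    coordB (todaFlow x M) (n + 1) = 2 * coordA x (n + 1) * entry M (n + 1) (n + 2)
      - 2 * coordA x n * entry M n (n + 1) := by
  by_cases h : n + 1 ≤ N
  · exact coordB_succ _ (⟨n, h⟩ : Fin N)
  · rw [coordB_eq_zero _ (by omega), coordA_eq_zero _ (by omega), coordA_eq_zero _ (by omega)]
    ring

/-- At distance 2 or more above the diagonal, [Π M, L] only sees entries where Π M agrees with M, so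
it equals [M, L] = 0 there. On the first superdiagonal Π deletes two diagonal entries of M, and
these give the difference in the flow. -/
lemma jacobiMatrix_todaFlow (x : TodaSpace N) {M : Matrix (Fin N) (Fin N) ℝ}
    (hM : M.transpose = M) (hc : Commute (jacobiMatrix x) M) :
    jacobiMatrix (todaFlow x M) = skewPart M * jacobiMatrix x - jacobiMatrix x * skewPart M := by
  apply symm_ext (jacobiMatrix_transpose _)
    (commutator_transpose (skewPart_transpose hM) (jacobiMatrix_transpose x))
  intro p d hd
  have hpq := congrArg (fun C => entry C (p + 1) (p + d + 1)) hc.eq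
  simp only [entry_jacobiMatrix_mul, entry_mul_jacobiMatrix] at hpq
  simp only [entry_sub, entry_jacobiMatrix_mul, entry_mul_jacobiMatrix, entry_skewPart,
    entry_jacobiMatrix]
  rcases d with _ | _ | d
  · simp [coordB_todaFlow]
    rw [entry_comm hM (p + 1) p, entry_comm hM (p + 2) (p + 1)]
    ring
  · simp [coordA_todaFlow] at hpq ⊢
    linear_combination hpq
  · iterate 3 rw [if_neg (by omega)]
    iterate 5 rw [if_pos (by omega)]
    linear_combination hpq

end Entries

/-! ### The three explicit brackets applied to the gradient of H_l. -/

section Algebra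

variable {N : ℕ}

/-- The gradient of `H_l` in terms of `M = L^{l-1}`. -/
def gradVec (M : Matrix (Fin N) (Fin N) ℝ) : TodaSpace N :=
  Sum.elim (fun i => 2 * entry M (i.val + 1) (i.val + 2))
    (fun i => entry M (i.val + 1) (i.val + 1))

lemma skewOfBrackets_mulVec_inl (u v w : ℕ → ℕ → ℝ) (M : Matrix (Fin N) (Fin N) ℝ)
    (i : Fin (N - 1)) :
    (skewOfBrackets N u v w).mulVec (gradVec M) (Sum.inl i) =
      ∑ q ∈ Finset.Icc 1 (N - 1),
        (u (i.val + 1) q - u q (i.val + 1)) * (2 * entry M q (q + 1))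
      + ∑ q ∈ Finset.Icc 1 N, v (i.val + 1) q * entry M q q := by
  rw [← sum_fin_succ_eq_sum_Icc, ← sum_fin_succ_eq_sum_Icc]
  simp [Matrix.mulVec, dotProduct, skewOfBrackets, gradVec]

lemma skewOfBrackets_mulVec_inr (u v w : ℕ → ℕ → ℝ) (M : Matrix (Fin N) (Fin N) ℝ)
    (i : Fin N) :
    (skewOfBrackets N u v w).mulVec (gradVec M) (Sum.inr i) =
      ∑ p ∈ Finset.Icc 1 (N - 1), - v p (i.val + 1) * (2 * entry M p (p + 1))
      + ∑ q ∈ Finset.Icc 1 N, (w (i.val + 1) q - w q (i.val + 1)) * entry M q q := by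
  rw [← sum_fin_succ_eq_sum_Icc, ← sum_fin_succ_eq_sum_Icc]
  simp [Matrix.mulVec, dotProduct, skewOfBrackets, gradVec]

lemma ite_mul_entry_diag (M : Matrix (Fin N) (Fin N) ℝ) (c : ℝ) (r : ℕ) :
    (if 1 ≤ r ∧ r ≤ N then c * entry M r r else 0) = c * entry M r r := by
  split_ifs with h
  · rfl
  · rw [entry_eq_zero M (fun h' => h h'.1), mul_zero]

lemma ite_mul_entry_offDiag (M : Matrix (Fin N) (Fin N) ℝ) (c : ℝ) (r : ℕ) :
    (if 1 ≤ r ∧ r ≤ N - 1 then c * (2 * entry M r (r + 1)) else 0)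
      = c * (2 * entry M r (r + 1)) := by
  split_ifs with h
  · rfl
  · rw [entry_eq_zero M (by omega), mul_zero, mul_zero]

lemma linearToda_mulVec (x : TodaSpace N) (M : Matrix (Fin N) (Fin N) ℝ) :
    (linearToda N x).mulVec (gradVec M) = todaFlow x M := by
  ext i
  rcases i with ⟨i, hi⟩ | ⟨j, hj⟩
  · rw [linearToda, skewOfBrackets_mulVec_inl]
    have e : ∀ q ∈ Finset.Icc 1 N, (if q = i + 1 then - coordA x (i + 1)
        else if q = i + 1 + 1 then coordA x (i + 1) else 0) * entry M q q
        = (if q = i + 1 then - coordA x (i + 1) * entry M q q else 0)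
          + (if q = i + 2 then coordA x (i + 1) * entry M q q else 0) := by
      intro q _
      split_ifs <;> first | omega | ring
    rw [Finset.sum_congr rfl e]
    simp only [sub_self, zero_mul, Finset.sum_const_zero, Finset.sum_add_distrib,
      Finset.sum_ite_eq', Finset.mem_Icc, ite_mul_entry_diag, todaFlow, Sum.elim_inl]
    ring
  · rw [linearToda, skewOfBrackets_mulVec_inr]
    have e : ∀ p ∈ Finset.Icc 1 (N - 1), -(if j + 1 = p then - coordA x p
        else if j + 1 = p + 1 then coordA x p else 0) * (2 * entry M p (p + 1))
        = (if p = j + 1 then coordA x p * (2 * entry M p (p + 1)) else 0)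
          + (if p = j then - coordA x p * (2 * entry M p (p + 1)) else 0) := by
      intro q _
      split_ifs <;> first | omega | ring
    rw [Finset.sum_congr rfl e]
    simp only [sub_self, zero_mul, Finset.sum_const_zero, Finset.sum_add_distrib,
      Finset.sum_ite_eq', Finset.mem_Icc, ite_mul_entry_offDiag, todaFlow, Sum.elim_inr]
    ring

/-- Compared with `linearToda_mulVec`, passing from π₁ to π₂ amounts to replacing M by LM: the
Lenard relation in its algebraic form, for any symmetric M commuting with L. -/
lemma quadraticToda_mulVec (x : TodaSpace N) {M : Matrix (Fin N) (Fin N) ℝ}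
    (hM : M.transpose = M) (hc : Commute (jacobiMatrix x) M) :
    (quadraticToda N x).mulVec (gradVec M) = todaFlow x (jacobiMatrix x * M) := by
  ext i
  rcases i with ⟨i, hi⟩ | ⟨j, hj⟩
  · rw [quadraticToda, skewOfBrackets_mulVec_inl]
    have e : ∀ q ∈ Finset.Icc 1 N, (if q = i + 1 then - coordA x (i + 1) * coordB x (i + 1)
        else if q = i + 1 + 1 then coordA x (i + 1) * coordB x (i + 1 + 1) else 0) * entry M q q
        = (if q = i + 1 then - coordA x (i + 1) * coordB x (i + 1) * entry M q q else 0)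
          + (if q = i + 2 then coordA x (i + 1) * coordB x (i + 2) * entry M q q else 0) := by
      intro q _
      split_ifs <;> first | omega | ring
    have e' : ∀ q ∈ Finset.Icc 1 (N - 1),
        ((if q = i + 1 + 1 then 1 / 2 * coordA x (i + 1) * coordA x (i + 1 + 1) else 0)
          - (if i + 1 = q + 1 then 1 / 2 * coordA x q * coordA x (q + 1) else 0))
            * (2 * entry M q (q + 1))
        = (if q = i + 2 then 1 / 2 * coordA x (i + 1) * coordA x (i + 2)
            * (2 * entry M q (q + 1)) else 0)
          + (if q = i then - (1 / 2 * coordA x q * coordA x (q + 1))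
            * (2 * entry M q (q + 1)) else 0) := by
      intro q _
      split_ifs <;> first | omega | ring
    rw [Finset.sum_congr rfl e, Finset.sum_congr rfl e']
    simp only [Finset.sum_add_distrib, Finset.sum_ite_eq', Finset.mem_Icc, ite_mul_entry_diag,
      ite_mul_entry_offDiag, todaFlow, Sum.elim_inl, entry_jacobiMatrix_mul]
    rw [entry_comm hM (i + 2 + 1) (i + 2), entry_comm hM (i + 2) (i + 1)]
    ring
  · rw [quadraticToda, skewOfBrackets_mulVec_inr]
    have e : ∀ p ∈ Finset.Icc 1 (N - 1), -(if j + 1 = p then - coordA x p * coordB x p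
        else if j + 1 = p + 1 then coordA x p * coordB x (p + 1) else 0)
          * (2 * entry M p (p + 1))
        = (if p = j + 1 then coordA x p * coordB x p * (2 * entry M p (p + 1)) else 0)
          + (if p = j then - coordA x p * coordB x (p + 1) * (2 * entry M p (p + 1)) else 0) := by
      intro q _
      split_ifs <;> first | omega | ring
    have e' : ∀ q ∈ Finset.Icc 1 N,
        ((if q = j + 1 + 1 then 2 * coordA x (j + 1) ^ 2 else 0)
          - (if j + 1 = q + 1 then 2 * coordA x q ^ 2 else 0)) * entry M q q
        = (if q = j + 2 then 2 * coordA x (j + 1) ^ 2 * entry M q q else 0)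
          + (if q = j then - (2 * coordA x q ^ 2) * entry M q q else 0) := by
      intro q _
      split_ifs <;> first | omega | ring
    rw [Finset.sum_congr rfl e, Finset.sum_congr rfl e']
    -- Reading (LM)_{j,j+1} as (ML)_{j,j+1} avoids row j − 1, hence covers j = 0, and makes the
    -- M_{j,j+2} terms cancel.
    have h2 := congrArg (fun C => entry C j (j + 1)) hc.eq
    simp only [entry_mul_jacobiMatrix] at h2
    simp only [Finset.sum_add_distrib, Finset.sum_ite_eq', Finset.mem_Icc, ite_mul_entry_diag,
      ite_mul_entry_offDiag, todaFlow, Sum.elim_inr, h2, entry_jacobiMatrix_mul]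
    ring

lemma cubicToda_mulVec (x : TodaSpace N) {M : Matrix (Fin N) (Fin N) ℝ}
    (hM : M.transpose = M) (hc : Commute (jacobiMatrix x) M) :
    (cubicToda N x).mulVec (gradVec M) = todaFlow x (jacobiMatrix x * (jacobiMatrix x * M)) := by
  ext i
  rcases i with ⟨i, hi⟩ | ⟨j, hj⟩
  · rw [cubicToda, skewOfBrackets_mulVec_inl]
    have e : ∀ q ∈ Finset.Icc 1 N,
        (if q = i + 1 then - coordA x (i + 1) * coordB x (i + 1) ^ 2 - coordA x (i + 1) ^ 3
        else if q = i + 1 + 1 then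
          coordA x (i + 1) * coordB x (i + 1 + 1) ^ 2 + coordA x (i + 1) ^ 3
        else if q = i + 1 + 2 then coordA x (i + 1) * coordA x (i + 1 + 1) ^ 2
        else if i + 1 = q + 1 then - coordA x q ^ 2 * coordA x (q + 1)
        else 0) * entry M q q
        = (if q = i + 1 then (- coordA x (i + 1) * coordB x (i + 1) ^ 2 - coordA x (i + 1) ^ 3)
            * entry M q q else 0)
          + (if q = i + 2 then (coordA x (i + 1) * coordB x (i + 2) ^ 2 + coordA x (i + 1) ^ 3)
            * entry M q q else 0)
          + (if q = i + 3 then coordA x (i + 1) * coordA x (i + 2) ^ 2 * entry M q q else 0)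
          + (if q = i then - coordA x q ^ 2 * coordA x (q + 1) * entry M q q else 0) := by
      intro q _
      split_ifs <;> first | omega | ring
    have e' : ∀ q ∈ Finset.Icc 1 (N - 1),
        ((if q = i + 1 + 1 then coordA x (i + 1) * coordA x (i + 1 + 1) * coordB x (i + 1 + 1)
            else 0)
          - (if i + 1 = q + 1 then coordA x q * coordA x (q + 1) * coordB x (q + 1) else 0))
            * (2 * entry M q (q + 1))
        = (if q = i + 2 then coordA x (i + 1) * coordA x (i + 2) * coordB x (i + 2)
            * (2 * entry M q (q + 1)) else 0)
          + (if q = i then - (coordA x q * coordA x (q + 1) * coordB x (q + 1))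
            * (2 * entry M q (q + 1)) else 0) := by
      intro q _
      split_ifs <;> first | omega | ring
    rw [Finset.sum_congr rfl e, Finset.sum_congr rfl e']
    have h2 := congrArg (fun C => entry C (i + 1) (i + 2)) hc.eq
    simp only [entry_mul_jacobiMatrix, entry_jacobiMatrix_mul] at h2
    have hcc : jacobiMatrix x * (jacobiMatrix x * M) = jacobiMatrix x * M * jacobiMatrix x := by
      rw [hc.eq, ← mul_assoc, hc.eq]
    simp only [Finset.sum_add_distrib, Finset.sum_ite_eq', Finset.mem_Icc, ite_mul_entry_diag,
      ite_mul_entry_offDiag, todaFlow, Sum.elim_inl, hcc, entry_mul_jacobiMatrix,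
      entry_jacobiMatrix_mul]
    rw [entry_comm hM (i + 2 + 1) (i + 2), entry_comm hM (i + 2) (i + 1),
      entry_comm hM (i + 1) i, entry_comm hM (i + 2 + 1) (i + 1), entry_comm hM (i + 2) i]
    -- The diagonal of LML yields the a³ terms with the opposite sign; twice the relation [L, M] = 0
    -- at this entry flips them.
    linear_combination 2 * coordA x (i + 1) ^ 2 * h2
  · rw [cubicToda, skewOfBrackets_mulVec_inr]
    have e : ∀ p ∈ Finset.Icc 1 (N - 1),
        -(if j + 1 = p then - coordA x p * coordB x p ^ 2 - coordA x p ^ 3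
        else if j + 1 = p + 1 then coordA x p * coordB x (p + 1) ^ 2 + coordA x p ^ 3
        else if j + 1 = p + 2 then coordA x p * coordA x (p + 1) ^ 2
        else if p = j + 1 + 1 then - coordA x (j + 1) ^ 2 * coordA x (j + 1 + 1)
        else 0) * (2 * entry M p (p + 1))
        = (if p = j + 1 then (coordA x p * coordB x p ^ 2 + coordA x p ^ 3)
            * (2 * entry M p (p + 1)) else 0)
          + (if p = j then - (coordA x p * coordB x (p + 1) ^ 2 + coordA x p ^ 3)
            * (2 * entry M p (p + 1)) else 0)
          + (if p = j - 1 then - (coordA x p * coordA x (p + 1) ^ 2)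
            * (2 * entry M p (p + 1)) else 0)
          + (if p = j + 2 then (coordA x (j + 1) ^ 2 * coordA x (j + 2))
            * (2 * entry M p (p + 1)) else 0) := by
      -- For j = 0 the truncated `j - 1` is 0, which the range of summation excludes.
      intro q hq
      rw [Finset.mem_Icc] at hq
      split_ifs <;> first | omega | ring
    have e' : ∀ q ∈ Finset.Icc 1 N,
        ((if q = j + 1 + 1 then 2 * coordA x (j + 1) ^ 2 * (coordB x (j + 1) + coordB x (j + 1 + 1))
            else 0)
          - (if j + 1 = q + 1 then 2 * coordA x q ^ 2 * (coordB x q + coordB x (q + 1)) else 0))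
            * entry M q q
        = (if q = j + 2 then 2 * coordA x (j + 1) ^ 2 * (coordB x (j + 1) + coordB x (j + 2))
            * entry M q q else 0)
          + (if q = j then - (2 * coordA x q ^ 2 * (coordB x q + coordB x (q + 1)))
            * entry M q q else 0) := by
      intro q _
      split_ifs <;> first | omega | ring
    rw [Finset.sum_congr rfl e, Finset.sum_congr rfl e']
    have hcc : jacobiMatrix x * (jacobiMatrix x * M) = M * jacobiMatrix x * jacobiMatrix x := by
      rw [hc.eq, ← mul_assoc, hc.eq]
    have h2 := congrArg (fun C => entry C j (j + 1)) hcc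
    have h3 := congrArg (fun C => entry C j (j + 2)) hc.eq
    rcases j with _ | j
    · simp only [Finset.sum_add_distrib, Finset.sum_ite_eq', Finset.mem_Icc, ite_mul_entry_diag,
        ite_mul_entry_offDiag, todaFlow, Sum.elim_inr, h2, entry_jacobiMatrix_mul,
        coordA_zero, entry_zero_left, Nat.zero_sub, mul_zero, ite_self]
      rw [entry_comm hM (0 + 1 + 2) (0 + 2)]
      ring
    · simp only [entry_mul_jacobiMatrix, entry_jacobiMatrix_mul] at h3
      simp only [Finset.sum_add_distrib, Finset.sum_ite_eq', Finset.mem_Icc, ite_mul_entry_diag,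
        ite_mul_entry_offDiag, todaFlow, Sum.elim_inr, h2, entry_mul_jacobiMatrix,
        entry_jacobiMatrix_mul, Nat.add_sub_cancel]
      rw [entry_comm hM (j + 1 + 1 + 2) (j + 1 + 2), entry_comm hM (j + 1) j]
      linear_combination - 2 * coordA x (j + 1) * coordA x (j + 2) * h3

/-! ### The Lax equations of X₁ and X₂. -/

lemma entry_jacobiMatrix_diag (x : TodaSpace N) {p q : ℕ} (h : q = p) :
    entry (jacobiMatrix x) p q = coordB x p := by
  rw [entry_jacobiMatrix]; subst h; simp

lemma entry_jacobiMatrix_upper (x : TodaSpace N) {p q : ℕ} (h : q = p + 1) :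
    entry (jacobiMatrix x) p q = coordA x p := by
  rw [entry_jacobiMatrix, if_neg (by omega), if_pos h, if_neg (by omega)]; simp

lemma entry_jacobiMatrix_lower (x : TodaSpace N) {p q : ℕ} (h : p = q + 1) :
    entry (jacobiMatrix x) p q = coordA x q := by
  rw [entry_jacobiMatrix, if_neg (by omega), if_neg (by omega), if_pos h]; simp

lemma entry_jacobiMatrix_far (x : TodaSpace N) {p q : ℕ} (h : p + 1 < q ∨ q + 1 < p) :
    entry (jacobiMatrix x) p q = 0 := by
  rw [entry_jacobiMatrix, if_neg (by omega), if_neg (by omega), if_neg (by omega)]; simp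

/-- The matrix `B` of the Lax equation of `X₁`. -/
def laxOne (N : ℕ) (x : TodaSpace N) : Matrix (Fin N) (Fin N) ℝ :=
  skewBand N (fun n => (n + 1) * coordA x n) (fun _ => 0)

/-- The matrix `B` of the Lax equation of `X₂`. -/
def laxTwo (N : ℕ) (x : TodaSpace N) : Matrix (Fin N) (Fin N) ℝ :=
  skewBand N (fun n => coordA x n * (n * (coordB x n + coordB x (n + 1)) + sigmaB x n))
    (fun n => n * coordA x n * coordA x (n + 1))

lemma sigmaB_succ (x : TodaSpace N) (n : ℕ) :
    sigmaB x (n + 2) = sigmaB x (n + 1) + coordB x (n + 1) := by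
  rw [sigmaB, Finset.sum_Ico_succ_top (by omega)]; rfl

lemma sigmaB_one (x : TodaSpace N) : sigmaB x 1 = 0 := by simp [sigmaB]

lemma coordA_masterOne (x : TodaSpace N) (n : ℕ) : coordA (masterOne N x) n =
    - (n : ℝ) * coordA x n * coordB x n + (n + 2) * coordA x n * coordB x (n + 1) :=
  coordA_fieldOfComponents (fun h => by simp [coordA_eq_zero x h])

lemma coordA_masterTwo (x : TodaSpace N) (n : ℕ) : coordA (masterTwo N x) n =
    (2 - n) * coordA x (n - 1) ^ 2 * coordA x n + (1 - n) * coordA x n * coordB x n ^ 2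
      + coordA x n * coordB x n * coordB x (n + 1)
      + (n + 1) * coordA x n * coordA x (n + 1) ^ 2
      + (n + 1) * coordA x n * coordB x (n + 1) ^ 2 + coordA x n ^ 3
      + sigmaB x n * coordA x n * (coordB x (n + 1) - coordB x n) :=
  coordA_fieldOfComponents (fun h => by simp [coordA_eq_zero x h])

lemma laxOne_transpose (x : TodaSpace N) : (laxOne N x).transpose = - laxOne N x :=
  skewBand_transpose _ _

/-- The weights n + 1 in B grow by one at each step, so [B, L] contributes −aₙaₙ₊₁ on the second
superdiagonal and cancels that of L²; the right side is therefore tridiagonal. -/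
lemma jacobiMatrix_masterOne (x : TodaSpace N) :
    jacobiMatrix (masterOne N x) =
      laxOne N x * jacobiMatrix x - jacobiMatrix x * laxOne N x + jacobiMatrix x ^ 2 := by
  apply symm_ext (jacobiMatrix_transpose _)
  · rw [Matrix.transpose_add, jacobiMatrix_pow_transpose,
      commutator_transpose (laxOne_transpose x) (jacobiMatrix_transpose x)]
  intro p d hd
  rw [pow_two, entry_add, entry_sub, laxOne, entry_skewBand_mul _ _ _ _ (by omega),
    entry_mul_skewBand _ _ _ _ hd, entry_jacobiMatrix_mul]
  simp only [zero_mul, sub_zero, add_zero]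
  rcases d with _ | _ | _ | d
  · simp (disch := omega) only [entry_jacobiMatrix_diag, entry_jacobiMatrix_upper,
      entry_jacobiMatrix_lower]
    rw [masterOne, coordB_fieldOfComponents (by omega)]
    simp only [Nat.add_sub_cancel]
    push_cast
    ring_nf
  · simp (disch := omega) only [entry_jacobiMatrix_diag, entry_jacobiMatrix_upper,
      entry_jacobiMatrix_far, coordA_masterOne]
    push_cast
    ring_nf
  · simp (disch := omega) only [entry_jacobiMatrix_upper, entry_jacobiMatrix_far]
    push_cast
    ring_nf
  · simp (disch := omega) only [entry_jacobiMatrix_far]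
    ring

lemma laxTwo_transpose (x : TodaSpace N) : (laxTwo N x).transpose = - laxTwo N x :=
  skewBand_transpose _ _

lemma jacobiMatrix_masterTwo (x : TodaSpace N) :
    jacobiMatrix (masterTwo N x) =
      laxTwo N x * jacobiMatrix x - jacobiMatrix x * laxTwo N x + jacobiMatrix x ^ 3 := by
  apply symm_ext (jacobiMatrix_transpose _)
  · rw [Matrix.transpose_add, jacobiMatrix_pow_transpose,
      commutator_transpose (laxTwo_transpose x) (jacobiMatrix_transpose x)]
  intro p d hd
  rw [pow_succ, pow_two, entry_add, entry_sub, laxTwo, entry_skewBand_mul _ _ _ _ (by omega),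
    entry_mul_skewBand _ _ _ _ hd, entry_mul_jacobiMatrix]
  simp only [entry_jacobiMatrix_mul]
  -- L³ and [B, L] reach at most the third superdiagonal. The first two rows are separate because
  -- truncated indices and the start of the partial sums occur there.
  rcases d with _ | _ | _ | _ | d <;> rcases p with _ | _ | p
  all_goals
    simp (disch := omega) only [entry_jacobiMatrix_diag, entry_jacobiMatrix_upper,
      entry_jacobiMatrix_lower, entry_jacobiMatrix_far, coordA_masterTwo, entry_zero_left,
      entry_zero_right, coordA_zero, zero_add, add_zero, Nat.sub_self,
      Nat.zero_sub, Nat.add_one_sub_one]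
    try rw [masterTwo, coordB_fieldOfComponents (by omega)]
    simp only [sigmaB_succ, sigmaB_one, zero_add, add_zero, Nat.add_sub_cancel, Nat.sub_self,
      coordA_zero]
    push_cast
    ring_nf

/-- The compatibility of two Lax equations: `Π [B, M] + [Π M, B] = B'`, where `Π` is `skewPart`. -/
lemma skewPart_commutator_skewBand {M : Matrix (Fin N) (Fin N) ℝ} (hM : M.transpose = M)
    {β γ β' γ' : ℕ → ℝ}
    (hβ : ∀ p, p + 2 ≤ N → β' (p + 1) = β (p + 1) * (entry M (p + 2) (p + 2)
      - entry M (p + 1) (p + 1)) + 2 * γ (p + 1) * entry M (p + 2) (p + 3)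
      - 2 * γ p * entry M p (p + 1))
    (hγ : ∀ p, p + 3 ≤ N → γ' (p + 1) = γ (p + 1) * (entry M (p + 3) (p + 3)
      - entry M (p + 1) (p + 1))) :
    skewPart (skewBand N β γ * M - M * skewBand N β γ)
      + (skewPart M * skewBand N β γ - skewBand N β γ * skewPart M) = skewBand N β' γ' := by
  apply skew_ext _ (skewBand_transpose _ _)
  · intro p d hd
    -- Above the diagonal Π[B, M] is [B, M], so the sum is [B, M − Π M]. Since M − Π M is lower
    -- triangular, it cannot push the band beyond the second superdiagonal, where only its diagonal
    -- contributes.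
    rw [entry_add, entry_skewPart, if_pos (by omega), entry_sub, entry_sub,
      entry_skewBand_mul _ _ _ _ (by omega), entry_mul_skewBand _ _ _ _ (by omega),
      entry_skewBand_mul _ _ _ _ (by omega), entry_mul_skewBand _ _ _ _ (by omega),
      entry_skewBand _ _ ⟨by omega, by omega⟩ ⟨by omega, hd⟩]
    simp only [entry_skewPart, Nat.add_sub_cancel]
    rcases d with _ | _ | d
    · simp (disch := omega) only [if_pos, if_neg]
      rcases p with _ | p
      · simp
        rw [hβ 0 hd, entry_comm hM (0 + 3) (0 + 2)]
        simp
        ring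
      · simp
        rw [hβ (p + 1) hd]
        rw [entry_comm hM (p + 1 + 3) (p + 1 + 2), entry_comm hM (p + 1 + 1) (p + 1)]
        ring
    · simp (disch := omega) only [if_pos, if_neg]
      simp
      rw [hγ p hd]
      ring
    · simp (disch := omega) only [if_pos, if_neg]
      simp
  · rw [Matrix.transpose_add, skewPart_transpose (commutator_transpose (skewBand_transpose _ _) hM),
      commutator_transpose_of_skew (skewPart_transpose hM) (skewBand_transpose _ _), neg_add]

end Algebra

/-! ### Derivatives of matrix functions, the gradient of H_l and the Leibniz rule. -/

section Calculus

variable {N : ℕ}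

/-- A matrix-valued function with smooth entries. -/
def MatSmooth (F : TodaSpace N → Matrix (Fin N) (Fin N) ℝ) : Prop :=
  ∀ i j, ContDiff ℝ ∞ (fun y => F y i j)

/-- The directional derivative of a matrix-valued function, taken entrywise. -/
def matDeriv (F : TodaSpace N → Matrix (Fin N) (Fin N) ℝ) (x v : TodaSpace N) :
    Matrix (Fin N) (Fin N) ℝ :=
  Matrix.of fun i j => fderiv ℝ (fun y => F y i j) x v

lemma ContDiff.differentiableAt_of_infty {E F : Type*} [NormedAddCommGroup E] [NormedSpace ℝ E]
    [NormedAddCommGroup F] [NormedSpace ℝ F] {f : E → F} (hf : ContDiff ℝ ∞ f) (x : E) :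
    DifferentiableAt ℝ f x :=
  (hf.differentiable (by simp)) x

lemma MatSmooth.differentiableAt {F : TodaSpace N → Matrix (Fin N) (Fin N) ℝ} (hF : MatSmooth F)
    (x : TodaSpace N) (i j : Fin N) : DifferentiableAt ℝ (fun y => F y i j) x :=
  (hF i j).differentiableAt_of_infty x

lemma MatSmooth.mul {F G : TodaSpace N → Matrix (Fin N) (Fin N) ℝ} (hF : MatSmooth F)
    (hG : MatSmooth G) : MatSmooth (fun y => F y * G y) := by
  intro i j
  simp only [Matrix.mul_apply]
  exact ContDiff.sum fun k _ => (hF i k).mul (hG k j)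

lemma MatSmooth.sub {F G : TodaSpace N → Matrix (Fin N) (Fin N) ℝ} (hF : MatSmooth F)
    (hG : MatSmooth G) : MatSmooth (fun y => F y - G y) :=
  fun i j => (hF i j).sub (hG i j)

lemma MatSmooth.pow {F : TodaSpace N → Matrix (Fin N) (Fin N) ℝ} (hF : MatSmooth F) (m : ℕ) :
    MatSmooth (fun y => F y ^ m) := by
  induction m with
  | zero => intro i j; simp only [pow_zero]; exact contDiff_const
  | succ m ih => simp only [pow_succ]; exact ih.mul hF

lemma MatSmooth.skewPart {F : TodaSpace N → Matrix (Fin N) (Fin N) ℝ} (hF : MatSmooth F) :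
    MatSmooth (fun y => skewPart (F y)) := by
  intro i j
  simp only [_root_.skewPart, Matrix.of_apply]
  split_ifs
  · exact hF i j
  · exact (hF i j).neg
  · exact contDiff_const

lemma matDeriv_mul {F G : TodaSpace N → Matrix (Fin N) (Fin N) ℝ} (hF : MatSmooth F)
    (hG : MatSmooth G) (x v : TodaSpace N) :
    matDeriv (fun y => F y * G y) x v = matDeriv F x v * G x + F x * matDeriv G x v := by
  ext i j
  simp only [matDeriv, Matrix.of_apply, Matrix.mul_apply, Matrix.add_apply]
  rw [fderiv_fun_sum (fun k _ => (hF.differentiableAt x i k).fun_mul (hG.differentiableAt x k j)),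
    sum_apply, ← Finset.sum_add_distrib]
  refine Finset.sum_congr rfl fun k _ => ?_
  rw [fderiv_fun_mul (hF.differentiableAt x i k) (hG.differentiableAt x k j)]
  simp
  ring

lemma matDeriv_add {F G : TodaSpace N → Matrix (Fin N) (Fin N) ℝ} (hF : MatSmooth F)
    (hG : MatSmooth G) (x v : TodaSpace N) :
    matDeriv (fun y => F y + G y) x v = matDeriv F x v + matDeriv G x v := by
  ext i j
  simp only [matDeriv, Matrix.of_apply, Matrix.add_apply]
  rw [fderiv_fun_add (hF.differentiableAt x i j) (hG.differentiableAt x i j)]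
  rfl

lemma matDeriv_sub {F G : TodaSpace N → Matrix (Fin N) (Fin N) ℝ} (hF : MatSmooth F)
    (hG : MatSmooth G) (x v : TodaSpace N) :
    matDeriv (fun y => F y - G y) x v = matDeriv F x v - matDeriv G x v := by
  ext i j
  simp only [matDeriv, Matrix.of_apply, Matrix.sub_apply]
  rw [fderiv_fun_sub (hF.differentiableAt x i j) (hG.differentiableAt x i j)]
  rfl

lemma matDeriv_skewPart (F : TodaSpace N → Matrix (Fin N) (Fin N) ℝ) (x v : TodaSpace N) :
    matDeriv (fun y => skewPart (F y)) x v = skewPart (matDeriv F x v) := by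
  ext i j
  simp only [matDeriv, skewPart, Matrix.of_apply]
  split_ifs
  · rfl
  · rw [fderiv_fun_neg]; rfl
  · simp

lemma trace_matDeriv {F : TodaSpace N → Matrix (Fin N) (Fin N) ℝ} (hF : MatSmooth F)
    (x v : TodaSpace N) : fderiv ℝ (fun y => (F y).trace) x v = (matDeriv F x v).trace := by
  simp only [Matrix.trace, Matrix.diag_apply, matDeriv, Matrix.of_apply]
  rw [fderiv_fun_sum (fun k _ => hF.differentiableAt x k k), _root_.sum_apply]

lemma contDiff_coordA (n : ℕ) : ContDiff ℝ ∞ (fun y : TodaSpace N => coordA y n) := by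
  unfold coordA
  split_ifs
  · exact contDiff_apply ℝ ℝ _
  · exact contDiff_const

lemma contDiff_coordB (n : ℕ) : ContDiff ℝ ∞ (fun y : TodaSpace N => coordB y n) := by
  unfold coordB
  split_ifs
  · exact contDiff_apply ℝ ℝ _
  · exact contDiff_const

lemma fderiv_coordA_comp {W : TodaSpace N → TodaSpace N} {x : TodaSpace N}
    (hW : DifferentiableAt ℝ W x) (n : ℕ) (v : TodaSpace N) :
    fderiv ℝ (fun y => coordA (W y) n) x v = coordA (fderiv ℝ W x v) n := by
  unfold coordA
  split_ifs
  · rw [fderiv_apply hW]; rfl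
  · simp

lemma fderiv_coordB_comp {W : TodaSpace N → TodaSpace N} {x : TodaSpace N}
    (hW : DifferentiableAt ℝ W x) (n : ℕ) (v : TodaSpace N) :
    fderiv ℝ (fun y => coordB (W y) n) x v = coordB (fderiv ℝ W x v) n := by
  unfold coordB
  split_ifs
  · rw [fderiv_apply hW]; rfl
  · simp

/-- The derivative is known only through its values, so that product rules can be assembled from
`HasFDerivAt` facts and evaluated afterwards. -/
lemma hasFDerivAt_coordA (n : ℕ) (x : TodaSpace N) :
    ∃ f : TodaSpace N →L[ℝ] ℝ, HasFDerivAt (fun y => coordA y n) f x ∧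
      ∀ v, f v = coordA v n :=
  ⟨_, ((contDiff_coordA n).differentiableAt_of_infty x).hasFDerivAt, fun v => by
    rw [fderiv_coordA_comp (W := fun y => y) differentiableAt_id, fderiv_fun_id]; rfl⟩

lemma hasFDerivAt_coordB (n : ℕ) (x : TodaSpace N) :
    ∃ f : TodaSpace N →L[ℝ] ℝ, HasFDerivAt (fun y => coordB y n) f x ∧
      ∀ v, f v = coordB v n :=
  ⟨_, ((contDiff_coordB n).differentiableAt_of_infty x).hasFDerivAt, fun v => by
    rw [fderiv_coordB_comp (W := fun y => y) differentiableAt_id, fderiv_fun_id]; rfl⟩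

lemma matSmooth_jacobiMatrix : MatSmooth (fun y : TodaSpace N => jacobiMatrix y) := by
  intro i j
  simp only [jacobiMatrix, Matrix.of_apply]
  split_ifs
  · exact contDiff_coordB _
  · exact contDiff_coordA _
  · exact contDiff_coordA _
  · exact contDiff_const

lemma matDeriv_jacobiMatrix_comp {W : TodaSpace N → TodaSpace N} {x : TodaSpace N}
    (hW : DifferentiableAt ℝ W x) (v : TodaSpace N) :
    matDeriv (fun y => jacobiMatrix (W y)) x v = jacobiMatrix (fderiv ℝ W x v) := by
  ext i j
  simp only [matDeriv, jacobiMatrix, Matrix.of_apply]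
  split_ifs
  · exact fderiv_coordB_comp hW _ v
  · exact fderiv_coordA_comp hW _ v
  · exact fderiv_coordA_comp hW _ v
  · simp

lemma matDeriv_jacobiMatrix (x v : TodaSpace N) :
    matDeriv (fun y => jacobiMatrix y) x v = jacobiMatrix v := by
  rw [matDeriv_jacobiMatrix_comp (W := fun y => y) differentiableAt_id, fderiv_fun_id]; rfl

lemma matSmooth_skewBand {β γ : TodaSpace N → ℕ → ℝ} (hβ : ∀ n, ContDiff ℝ ∞ fun y => β y n)
    (hγ : ∀ n, ContDiff ℝ ∞ fun y => γ y n) : MatSmooth (fun y => skewBand N (β y) (γ y)) := by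
  intro i j
  simp only [skewBand, Matrix.of_apply]
  refine ((ContDiff.add ?_ ?_).sub (ContDiff.add ?_ ?_)) <;> split_ifs <;>
    first | exact hβ _ | exact hγ _ | exact contDiff_const

lemma matDeriv_skewBand {β γ : TodaSpace N → ℕ → ℝ} (hβ : ∀ n, ContDiff ℝ ∞ fun y => β y n)
    (hγ : ∀ n, ContDiff ℝ ∞ fun y => γ y n) (x v : TodaSpace N) :
    matDeriv (fun y => skewBand N (β y) (γ y)) x v =
      skewBand N (fun n => fderiv ℝ (fun y => β y n) x v)
        (fun n => fderiv ℝ (fun y => γ y n) x v) := by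
  ext i j
  simp only [matDeriv, skewBand, Matrix.of_apply]
  have h1 : ∀ (f : TodaSpace N → ℝ) (c : Prop) [Decidable c], ContDiff ℝ ∞ f →
      HasFDerivAt (fun y => if c then f y else 0) (if c then fderiv ℝ f x else 0) x := by
    intro f c _ hf
    split_ifs
    · exact (hf.differentiableAt_of_infty x).hasFDerivAt
    · exact hasFDerivAt_const _ _
  rw [(((h1 _ _ (hβ _)).fun_add (h1 _ _ (hγ _))).fun_sub
    ((h1 _ _ (hβ _)).fun_add (h1 _ _ (hγ _)))).fderiv]
  simp only [_root_.sub_apply, _root_.add_apply]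
  congr 2 <;> split_ifs <;> rfl

/-- The derivative of `L^m` along a vector field with Lax equation `L' = [A, L] + c L^{k+1}`. -/
lemma matDeriv_jacobiMatrix_pow {x v : TodaSpace N} {A : Matrix (Fin N) (Fin N) ℝ} {c : ℝ} {k : ℕ}
    (h : jacobiMatrix v = A * jacobiMatrix x - jacobiMatrix x * A + c • jacobiMatrix x ^ (k + 1))
    (m : ℕ) :
    matDeriv (fun y => jacobiMatrix y ^ m) x v =
      A * jacobiMatrix x ^ m - jacobiMatrix x ^ m * A + (m * c) • jacobiMatrix x ^ (m + k) := by
  induction m with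
  | zero => ext i j; simp [matDeriv]
  | succ m ih =>
    simp only [pow_succ (n := m)]
    rw [matDeriv_mul (matSmooth_jacobiMatrix.pow m) matSmooth_jacobiMatrix, ih,
      matDeriv_jacobiMatrix, h, add_right_comm m 1 k, pow_succ _ (m + k),
      mul_add (jacobiMatrix x ^ m), add_mul, mul_smul_comm, smul_mul_assoc, ← pow_add,
      ← add_assoc m k 1, pow_succ _ (m + k)]
    push_cast
    simp only [mul_sub, sub_mul, mul_assoc, add_mul, add_smul, one_mul]
    abel

/-- The factor L^s is what lets the induction close: the last L split off from the power is cycled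
to the front under the trace and raises s by one. -/
lemma trace_mul_matDeriv_pow (x v : TodaSpace N) (m s : ℕ) :
    (jacobiMatrix x ^ s * matDeriv (fun y => jacobiMatrix y ^ (m + 1)) x v).trace =
      (m + 1) * (jacobiMatrix x ^ (s + m) * jacobiMatrix v).trace := by
  induction m generalizing s with
  | zero => simp [matDeriv_jacobiMatrix]
  | succ m ih =>
    simp only [pow_succ _ (m + 1)]
    rw [matDeriv_mul (matSmooth_jacobiMatrix.pow (m + 1)) matSmooth_jacobiMatrix,
      matDeriv_jacobiMatrix, mul_add, Matrix.trace_add, ← mul_assoc, ← mul_assoc, ← pow_add,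
      Matrix.trace_mul_comm, ← mul_assoc, ← pow_succ', ih, add_right_comm s 1 m, add_assoc s m 1]
    push_cast
    ring

lemma contDiff_todaH (l : ℕ) : ContDiff ℝ ∞ (todaH N l) := by
  unfold todaH
  refine contDiff_const.mul ?_
  simp only [Matrix.trace, Matrix.diag_apply]
  exact ContDiff.sum fun k _ => (matSmooth_jacobiMatrix.pow l) k k

lemma fderiv_todaH (m : ℕ) (x v : TodaSpace N) :
    fderiv ℝ (todaH N (m + 1)) x v = (jacobiMatrix x ^ m * jacobiMatrix v).trace := by
  have hd : DifferentiableAt ℝ (fun y : TodaSpace N => (jacobiMatrix y ^ (m + 1)).trace) x := by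
    refine ContDiff.differentiableAt_of_infty ?_ x
    simp only [Matrix.trace, Matrix.diag_apply]
    exact ContDiff.sum fun k _ => (matSmooth_jacobiMatrix.pow (m + 1)) k k
  have := trace_mul_matDeriv_pow x v m 0
  rw [pow_zero, one_mul, zero_add] at this
  unfold todaH
  rw [fderiv_const_mul hd, _root_.smul_apply,
    trace_matDeriv (matSmooth_jacobiMatrix.pow (m + 1)), this, smul_eq_mul]
  push_cast
  field_simp

/-- Each aₚ occupies two symmetric positions of L, whence the factor 2 in `gradVec`. -/
lemma trace_jacobiMatrix_mul {M : Matrix (Fin N) (Fin N) ℝ} (hM : M.transpose = M)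
    (v : TodaSpace N) : (jacobiMatrix v * M).trace = ∑ i, v i * gradVec M i := by
  have hsub : ∀ f : ℕ → ℝ, (∀ p, coordA v p = 0 → f p = 0) → ∀ s : Finset ℕ,
      Finset.Icc 1 (N - 1) ⊆ s → ∑ p ∈ s, f p = ∑ p ∈ Finset.Icc 1 (N - 1), f p := by
    intro f hf s hs
    refine (Finset.sum_subset hs fun p _ hp => hf p (coordA_eq_zero v ?_)).symm
    simpa using hp
  have e1 : ∑ j : Fin N, coordA v j.val * entry M j.val (j.val + 1) =
      ∑ p ∈ Finset.Icc 1 (N - 1), coordA v p * entry M p (p + 1) := by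
    rw [Fin.sum_univ_eq_sum_range (fun p => coordA v p * entry M p (p + 1))]
    refine hsub _ (fun p h => by rw [h, zero_mul]) _ fun p hp => ?_
    simp only [Finset.mem_Icc, Finset.mem_range] at hp ⊢
    omega
  have e2 : ∑ j : Fin N, coordA v (j.val + 1) * entry M (j.val + 2) (j.val + 1) =
      ∑ p ∈ Finset.Icc 1 (N - 1), coordA v p * entry M p (p + 1) := by
    rw [sum_fin_succ_eq_sum_Icc N (fun p => coordA v p * entry M (p + 1) p)]
    simp only [entry_comm hM _ (_ + 1)]
    refine hsub _ (fun p h => by rw [h, zero_mul]) _ fun p hp => ?_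
    simp only [Finset.mem_Icc] at hp ⊢
    omega
  rw [trace_eq_sum_entry, ← sum_fin_succ_eq_sum_Icc]
  simp only [entry_jacobiMatrix_mul, Finset.sum_add_distrib]
  rw [e1, e2, Fintype.sum_sum_type]
  have e3 : ∑ i : Fin (N - 1), coordA v (i.val + 1) * (2 * entry M (i.val + 1) (i.val + 2)) =
      ∑ p ∈ Finset.Icc 1 (N - 1), coordA v p * (2 * entry M p (p + 1)) :=
    sum_fin_succ_eq_sum_Icc (N - 1) (fun p => coordA v p * (2 * entry M p (p + 1)))
  simp only [gradVec, Sum.elim_inl, Sum.elim_inr, ← coordA_succ v, ← coordB_succ v]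
  rw [e3]
  simp only [mul_left_comm _ (2 : ℝ), ← Finset.mul_sum]
  ring

lemma coordGrad_todaH (m : ℕ) (x : TodaSpace N) :
    coordGrad (todaH N (m + 1)) x = gradVec (jacobiMatrix x ^ m) := by
  ext i
  rw [coordGrad, fderiv_todaH, Matrix.trace_mul_comm,
    trace_jacobiMatrix_mul (jacobiMatrix_pow_transpose x m)]
  simp [Pi.single_apply]

lemma contDiff_coordGrad {f : TodaSpace N → ℝ} (hf : ContDiff ℝ ∞ f) (i : TodaIndex N) :
    ContDiff ℝ ∞ (fun x => coordGrad f x i) :=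
  (hf.fderiv_right (m := ∞) (by simp)).clm_apply contDiff_const

lemma contDiff_hamiltonianField {P : TodaTensor N} (hP : ∀ i j, ContDiff ℝ ∞ (fun x => P x i j))
    {f : TodaSpace N → ℝ} (hf : ContDiff ℝ ∞ f) : ContDiff ℝ ∞ (hamiltonianField P f) := by
  refine contDiff_pi.2 fun i => ?_
  simp only [hamiltonianField, Matrix.mulVec, dotProduct]
  exact ContDiff.sum fun j _ => (hP i j).mul (contDiff_coordGrad hf j)

lemma fderiv_apply_eq_sum_coordGrad (f : TodaSpace N → ℝ) (x v : TodaSpace N) :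
    fderiv ℝ f x v = ∑ k, v k * coordGrad f x k := by
  conv_lhs => rw [pi_eq_sum_univ' v]
  simp only [map_sum, map_smul, smul_eq_mul, coordGrad]

lemma minSmoothness_two_le_infty : minSmoothness ℝ 2 ≤ ∞ := by
  rw [minSmoothness_of_isRCLikeNormedField]
  exact WithTop.coe_le_coe.2 le_top

/-- The Leibniz rule `L_X (P ∇f) = (L_X P) ∇f + P ∇(X f)`. -/
lemma hamiltonianField_lieDerivTensor {X : TodaSpace N → TodaSpace N} (hX : ContDiff ℝ ∞ X)
    {P : TodaTensor N} (hP : ∀ i j, ContDiff ℝ ∞ (fun x => P x i j))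
    {f : TodaSpace N → ℝ} (hf : ContDiff ℝ ∞ f) (x : TodaSpace N) :
    hamiltonianField (lieDerivTensor X P) f x =
      VectorField.lieBracket ℝ X (hamiltonianField P f) x
        - hamiltonianField P (fun y => fderiv ℝ f y (X y)) x := by
  have hgrad : ∀ j, fderiv ℝ (fun y => coordGrad f y j) x (X x) =
      coordGrad (fun y => fderiv ℝ f y (X y)) x j
        - ∑ k, coordGrad (fun y => X y k) x j * coordGrad f x k := by
    intro j
    -- With the constant field ∂ⱼ this is the symmetry of second derivatives: ∂ⱼ(X f) = X(∂ⱼ f) +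
    -- (∂ⱼX) f.
    have h := VectorField.fderiv_apply_lieBracket (V := fun _ : TodaSpace N => Pi.single j (1 : ℝ))
      (hf.contDiffAt (x := x)) minSmoothness_two_le_infty
      (hX.differentiableAt_of_infty x) (differentiableAt_const _)
    simp only [VectorField.lieBracket, fderiv_fun_const, Pi.zero_apply,
      _root_.zero_apply, sub_zero] at h
    rw [fderiv_apply_eq_sum_coordGrad f x (fderiv ℝ X x _)] at h
    have hk : ∀ k, fderiv ℝ X x (Pi.single j 1) k = coordGrad (fun y => X y k) x j := by
      intro k
      rw [coordGrad, fderiv_apply (hX.differentiableAt_of_infty x)]; rfl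
    simp only [hk] at h
    rw [h]
    simp only [coordGrad]
    ring
  ext i
  have hlie : VectorField.lieBracket ℝ X (hamiltonianField P f) x i =
      ∑ j, ((∑ k, X x k * coordGrad (fun y => P y i j) x k) * coordGrad f x j
        + P x i j * (coordGrad (fun y => fderiv ℝ f y (X y)) x j
        - ∑ k, coordGrad (fun y => X y k) x j * coordGrad f x k))
      - ∑ k, (∑ j, P x k j * coordGrad f x j) * coordGrad (fun y => X y i) x k := by
    have h1 : fderiv ℝ (hamiltonianField P f) x (X x) i
        = fderiv ℝ (fun y => hamiltonianField P f y i) x (X x) := by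
      rw [fderiv_apply ((contDiff_hamiltonianField hP hf).differentiableAt_of_infty x)]; rfl
    have h2 : fderiv ℝ X x (hamiltonianField P f x) i
        = fderiv ℝ (fun y => X y i) x (hamiltonianField P f x) := by
      rw [fderiv_apply (hX.differentiableAt_of_infty x)]; rfl
    rw [VectorField.lieBracket, Pi.sub_apply, h1, h2,
      fderiv_apply_eq_sum_coordGrad (fun y => X y i)]
    congr 1
    simp only [hamiltonianField, Matrix.mulVec, dotProduct]
    have hPd := fun j => (hP i j).differentiableAt_of_infty x
    have hfd := fun j => (contDiff_coordGrad hf j).differentiableAt_of_infty x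
    rw [fderiv_fun_sum (fun j _ => (hPd j).fun_mul (hfd j)), _root_.sum_apply]
    refine Finset.sum_congr rfl fun j _ => ?_
    rw [fderiv_fun_mul (hPd j) (hfd j), _root_.add_apply, _root_.smul_apply, _root_.smul_apply,
      hgrad, fderiv_apply_eq_sum_coordGrad (fun y => P y i j)]
    simp only [smul_eq_mul]
    ring
  rw [Pi.sub_apply, hlie]
  simp only [hamiltonianField, Matrix.mulVec, dotProduct, lieDerivTensor, Matrix.of_apply,
    Finset.sum_sub_distrib, Finset.sum_add_distrib, sub_mul, mul_sub, Finset.sum_mul,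
    Finset.mul_sum]
  have e1 : ∑ j, ∑ k, coordGrad (fun y => X y i) x k * P x k j * coordGrad f x j =
      ∑ k, ∑ j, P x k j * coordGrad f x j * coordGrad (fun y => X y i) x k := by
    rw [Finset.sum_comm]
    exact Finset.sum_congr rfl fun k _ => Finset.sum_congr rfl fun j _ => by ring
  have e2 : ∑ j, ∑ k, coordGrad (fun y => X y j) x k * P x i k * coordGrad f x j =
      ∑ j, ∑ k, P x i j * (coordGrad (fun y => X y k) x j * coordGrad f x k) := by
    rw [Finset.sum_comm]
    exact Finset.sum_congr rfl fun k _ => Finset.sum_congr rfl fun j _ => by ring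
  rw [e1, e2]
  ring

end Calculus

/-! ### The flows χ, and the master symmetries acting on H_l and on χ. -/

section Hierarchy

variable {N : ℕ}

lemma jacobiMatrix_sub (x y : TodaSpace N) :
    jacobiMatrix (x - y) = jacobiMatrix x - jacobiMatrix y := by
  have hA : ∀ n, coordA (x - y) n = coordA x n - coordA y n := by
    intro n; unfold coordA; split_ifs <;> simp
  have hB : ∀ n, coordB (x - y) n = coordB x n - coordB y n := by
    intro n; unfold coordB; split_ifs <;> simp
  ext i j
  simp only [jacobiMatrix, Matrix.of_apply, Matrix.sub_apply, hA, hB]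
  split_ifs <;> simp

lemma jacobiMatrix_smul (c : ℝ) (x : TodaSpace N) :
    jacobiMatrix (c • x) = c • jacobiMatrix x := by
  have hA : ∀ n, coordA (c • x) n = c * coordA x n := by
    intro n; unfold coordA; split_ifs <;> simp
  have hB : ∀ n, coordB (c • x) n = c * coordB x n := by
    intro n; unfold coordB; split_ifs <;> simp
  ext i j
  simp only [jacobiMatrix, Matrix.of_apply, Matrix.smul_apply, hA, hB]
  split_ifs <;> simp

/-- The isospectral flows `χ_{m+1} = π₁ ∇H_{m+1}`, with `aₚ' = aₚ ((L^m)_{p+1,p+1} - (L^m)_{p,p})`. -/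
def chi (N m : ℕ) : TodaSpace N → TodaSpace N := fun x => todaFlow x (jacobiMatrix x ^ m)

lemma hamiltonianField_linearToda (m : ℕ) :
    hamiltonianField (linearToda N) (todaH N (m + 1)) = chi N m := by
  ext1 x
  rw [hamiltonianField, coordGrad_todaH, linearToda_mulVec]; rfl

lemma hamiltonianField_quadraticToda (m : ℕ) :
    hamiltonianField (quadraticToda N) (todaH N (m + 1)) = chi N (m + 1) := by
  ext1 x
  rw [hamiltonianField, coordGrad_todaH, quadraticToda_mulVec x (jacobiMatrix_pow_transpose x m)
    (Commute.self_pow _ _), ← pow_succ']; rfl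

lemma hamiltonianField_cubicToda (m : ℕ) :
    hamiltonianField (cubicToda N) (todaH N (m + 1)) = chi N (m + 2) := by
  ext1 x
  rw [hamiltonianField, coordGrad_todaH, cubicToda_mulVec x (jacobiMatrix_pow_transpose x m)
    (Commute.self_pow _ _), ← pow_succ', ← pow_succ']; rfl

lemma contDiff_linearToda (i j : TodaIndex N) : ContDiff ℝ ∞ (fun x => linearToda N x i j) := by
  have hv : ∀ p q : ℕ, ContDiff ℝ ∞ (fun x : TodaSpace N =>
      if q = p then - coordA x p else if q = p + 1 then coordA x p else 0) := by
    intro p q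
    split_ifs
    · exact (contDiff_coordA _).neg
    · exact contDiff_coordA _
    · exact contDiff_const
  rcases i with i | i <;> rcases j with j | j <;>
    simp only [linearToda, skewOfBrackets, Matrix.fromBlocks_apply₁₁, Matrix.fromBlocks_apply₁₂,
      Matrix.fromBlocks_apply₂₁, Matrix.fromBlocks_apply₂₂, Matrix.of_apply]
  · exact contDiff_const
  · exact hv _ _
  · exact (hv _ _).neg
  · exact contDiff_const

lemma linearToda_transpose (x : TodaSpace N) :
    (linearToda N x).transpose = - linearToda N x := by
  ext i j
  rcases i with i | i <;> rcases j with j | j <;> simp [linearToda, skewOfBrackets]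

lemma contDiff_quadraticToda (i j : TodaIndex N) :
    ContDiff ℝ ∞ (fun x => quadraticToda N x i j) := by
  have hA := contDiff_coordA (N := N)
  have hB := contDiff_coordB (N := N)
  rcases i with i | i <;> rcases j with j | j <;>
    simp only [quadraticToda, skewOfBrackets, Matrix.fromBlocks_apply₁₁,
      Matrix.fromBlocks_apply₁₂, Matrix.fromBlocks_apply₂₁, Matrix.fromBlocks_apply₂₂,
      Matrix.of_apply] <;>
    split_ifs <;> fun_prop

lemma quadraticToda_transpose (x : TodaSpace N) :
    (quadraticToda N x).transpose = - quadraticToda N x := by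
  ext i j
  rcases i with i | i <;> rcases j with j | j <;> simp [quadraticToda, skewOfBrackets]

lemma contDiff_cubicToda (i j : TodaIndex N) :
    ContDiff ℝ ∞ (fun x => cubicToda N x i j) := by
  have hA := contDiff_coordA (N := N)
  have hB := contDiff_coordB (N := N)
  rcases i with i | i <;> rcases j with j | j <;>
    simp only [cubicToda, skewOfBrackets, Matrix.fromBlocks_apply₁₁,
      Matrix.fromBlocks_apply₁₂, Matrix.fromBlocks_apply₂₁, Matrix.fromBlocks_apply₂₂,
      Matrix.of_apply] <;>
    split_ifs <;> fun_prop

lemma cubicToda_transpose (x : TodaSpace N) :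
    (cubicToda N x).transpose = - cubicToda N x := by
  ext i j
  rcases i with i | i <;> rcases j with j | j <;> simp [cubicToda, skewOfBrackets]

lemma contDiff_chi (m : ℕ) : ContDiff ℝ ∞ (chi N m) := by
  rw [← hamiltonianField_linearToda]
  exact contDiff_hamiltonianField contDiff_linearToda (contDiff_todaH _)

lemma contDiff_masterOne : ContDiff ℝ ∞ (masterOne N) := by
  have hA := contDiff_coordA (N := N)
  have hB := contDiff_coordB (N := N)
  refine contDiff_pi.2 fun i => ?_
  rcases i with i | i <;> simp only [masterOne, fieldOfComponents, Sum.elim_inl, Sum.elim_inr] <;>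
    fun_prop

lemma contDiff_sigmaB (n : ℕ) : ContDiff ℝ ∞ (fun x : TodaSpace N => sigmaB x n) :=
  ContDiff.sum fun i _ => contDiff_coordB i

lemma contDiff_masterTwo : ContDiff ℝ ∞ (masterTwo N) := by
  have hA := contDiff_coordA (N := N)
  have hB := contDiff_coordB (N := N)
  have hS := contDiff_sigmaB (N := N)
  refine contDiff_pi.2 fun i => ?_
  rcases i with i | i <;> simp only [masterTwo, fieldOfComponents, Sum.elim_inl, Sum.elim_inr] <;>
    fun_prop

lemma contDiff_masterSymmetry : ∀ k, ContDiff ℝ ∞ (masterSymmetry N k)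
  | 0 => contDiff_id
  | 1 => contDiff_masterOne
  | 2 => contDiff_masterTwo
  | k + 3 => contDiff_const.smul
      (contDiff_masterOne.lieBracket_vectorField (contDiff_masterSymmetry (k + 2)) (m := ∞) (by simp))

lemma contDiff_lieDerivTensor {X : TodaSpace N → TodaSpace N} (hX : ContDiff ℝ ∞ X)
    {P : TodaTensor N} (hP : ∀ i j, ContDiff ℝ ∞ (fun x => P x i j)) (i j : TodaIndex N) :
    ContDiff ℝ ∞ (fun x => lieDerivTensor X P x i j) := by
  have hXi := contDiff_pi.1 hX
  simp only [lieDerivTensor, Matrix.of_apply]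
  exact ContDiff.sum fun k _ => (((hXi k).mul (contDiff_coordGrad (hP i j) k)).sub
    ((contDiff_coordGrad (hXi i) k).mul (hP k j))).sub
    ((contDiff_coordGrad (hXi j) k).mul (hP i k))

lemma lieDerivTensor_transpose (X : TodaSpace N → TodaSpace N) {P : TodaTensor N}
    (hP : ∀ x, (P x).transpose = - P x) (x : TodaSpace N) :
    (lieDerivTensor X P x).transpose = - lieDerivTensor X P x := by
  have hij : ∀ y i j, P y j i = - P y i j := fun y i j => congrFun (congrFun (hP y) i) j
  ext i j
  simp only [lieDerivTensor, Matrix.transpose_apply, Matrix.neg_apply, Matrix.of_apply]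
  rw [← Finset.sum_neg_distrib]
  refine Finset.sum_congr rfl fun k _ => ?_
  have e : coordGrad (fun y => P y j i) x k = - coordGrad (fun y => P y i j) x k := by
    simp only [coordGrad, hij _ i j]
    rw [fderiv_fun_neg]; rfl
  rw [e, hij x i k, hij x k j]
  ring

/-- A vector field with Lax equation `L' = [B, L] + L^{k+1}` maps `H_l` to `(l + k) H_{l+k}`. -/
lemma fderiv_todaH_of_lax {k : ℕ} {x v : TodaSpace N} {B : Matrix (Fin N) (Fin N) ℝ}
    (h : jacobiMatrix v = B * jacobiMatrix x - jacobiMatrix x * B + jacobiMatrix x ^ (k + 1))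
    (m : ℕ) :
    fderiv ℝ (todaH N (m + 1)) x v = ((m : ℝ) + 1 + k) * todaH N (m + 1 + k) x := by
  rw [fderiv_todaH, h, mul_add, mul_sub, Matrix.trace_add, Matrix.trace_sub, ← pow_add,
    ← mul_assoc, ← mul_assoc, Matrix.trace_mul_comm (_ * B), ← mul_assoc, ← pow_succ, ← pow_succ',
    sub_self, zero_add, todaH]
  have : (m : ℝ) + 1 + k ≠ 0 := by positivity
  push_cast
  field_simp
  congr 2
  omega

/-- The bracket of a vector field with Lax equation `L' = [B, L] + L^{k+1}` with the isospectral
flows. -/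
lemma lieBracket_chi_of_lax {k : ℕ} {X : TodaSpace N → TodaSpace N} (hX : ContDiff ℝ ∞ X)
    {B : TodaSpace N → Matrix (Fin N) (Fin N) ℝ} (hB : MatSmooth B)
    (hlax : ∀ x, jacobiMatrix (X x) =
      B x * jacobiMatrix x - jacobiMatrix x * B x + jacobiMatrix x ^ (k + 1))
    (hcomp : ∀ x m, skewPart (B x * jacobiMatrix x ^ m - jacobiMatrix x ^ m * B x)
      + (skewPart (jacobiMatrix x ^ m) * B x - B x * skewPart (jacobiMatrix x ^ m))
      = matDeriv B x (chi N m x)) (m : ℕ) (x : TodaSpace N) :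
    VectorField.lieBracket ℝ X (chi N m) x = (m : ℝ) • chi N (m + k) x := by
  have hL := matSmooth_jacobiMatrix (N := N)
  have hflow : ∀ m x, jacobiMatrix (chi N m x) = skewPart (jacobiMatrix x ^ m) * jacobiMatrix x
      - jacobiMatrix x * skewPart (jacobiMatrix x ^ m) := fun m x =>
    jacobiMatrix_todaFlow x (jacobiMatrix_pow_transpose x m) (Commute.self_pow _ _)
  have hS := (hL.pow m).skewPart
  have hDM : matDeriv (fun y => jacobiMatrix y ^ m) x (X x) =
      B x * jacobiMatrix x ^ m - jacobiMatrix x ^ m * B x + (m : ℝ) • jacobiMatrix x ^ (m + k) := by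
    rw [matDeriv_jacobiMatrix_pow (c := 1) (k := k) (by rw [hlax, one_smul]), mul_one]
  have hDL : matDeriv (fun y => jacobiMatrix y ^ (k + 1)) x (chi N m x) =
      skewPart (jacobiMatrix x ^ m) * jacobiMatrix x ^ (k + 1)
        - jacobiMatrix x ^ (k + 1) * skewPart (jacobiMatrix x ^ m) := by
    -- The flow is isospectral, so its Lax equation has no inhomogeneous term; the value of k is
    -- immaterial.
    rw [matDeriv_jacobiMatrix_pow (c := 0) (k := 0) (by rw [hflow, zero_smul, add_zero]),
      mul_zero, zero_smul, add_zero]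
  have h1 : jacobiMatrix (fderiv ℝ (chi N m) x (X x)) =
      matDeriv (fun y => skewPart (jacobiMatrix y ^ m) * jacobiMatrix y
        - jacobiMatrix y * skewPart (jacobiMatrix y ^ m)) x (X x) := by
    rw [← matDeriv_jacobiMatrix_comp ((contDiff_chi m).differentiableAt_of_infty x)]
    simp only [hflow]
  have h2 : jacobiMatrix (fderiv ℝ X x (chi N m x)) =
      matDeriv (fun y => (B y * jacobiMatrix y - jacobiMatrix y * B y)
        + jacobiMatrix y ^ (k + 1)) x (chi N m x) := by
    rw [← matDeriv_jacobiMatrix_comp (hX.differentiableAt_of_infty x)]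
    simp only [hlax]
  rw [matDeriv_sub (hS.mul hL) (hL.mul hS), matDeriv_mul hS hL, matDeriv_mul hL hS,
    matDeriv_skewPart, matDeriv_jacobiMatrix, hDM, skewPart_add, skewPart_smul, hlax] at h1
  rw [matDeriv_add ((hB.mul hL).sub (hL.mul hB)) (hL.pow _), matDeriv_sub (hB.mul hL) (hL.mul hB),
    matDeriv_mul hB hL, matDeriv_mul hL hB, matDeriv_jacobiMatrix, hDL, hflow, ← hcomp] at h2
  apply eq_of_jacobiMatrix_eq
  rw [VectorField.lieBracket, jacobiMatrix_sub, jacobiMatrix_smul, h1, h2, hflow]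
  -- With M = L^m, the terms [Π M, L^{k+1}] cancel. By Jacobi, [Π M, [B, L]] − [B, [Π M, L]] = [[Π
  -- M, B], L], which `hcomp` absorbs; only m [Π L^{m+k}, L] survives.
  simp only [smul_sub, ← smul_mul_assoc]
  noncomm_ring

/-! ### Compatibility of the matrices B with the flows, and the recursion along X_k. -/

lemma matSmooth_laxOne : MatSmooth (laxOne N) :=
  matSmooth_skewBand (fun n => contDiff_const.mul (contDiff_coordA n)) (fun _ => contDiff_const)

lemma contDiff_laxTwo_upper (n : ℕ) : ContDiff ℝ ∞ (fun x : TodaSpace N =>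
    coordA x n * (n * (coordB x n + coordB x (n + 1)) + sigmaB x n)) := by
  have hA := contDiff_coordA (N := N)
  have hB := contDiff_coordB (N := N)
  have hS := contDiff_sigmaB (N := N)
  fun_prop

lemma contDiff_laxTwo_second (n : ℕ) : ContDiff ℝ ∞ (fun x : TodaSpace N =>
    n * coordA x n * coordA x (n + 1)) := by
  have hA := contDiff_coordA (N := N)
  fun_prop

lemma matSmooth_laxTwo : MatSmooth (laxTwo N) :=
  matSmooth_skewBand contDiff_laxTwo_upper contDiff_laxTwo_second

/-- Along the flow each bₙ changes by a difference of consecutive terms, so the partial sum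
telescopes. -/
lemma sigmaB_chi (x : TodaSpace N) (m p : ℕ) :
    sigmaB (chi N m x) (p + 1) = 2 * coordA x p * entry (jacobiMatrix x ^ m) p (p + 1) := by
  induction p with
  | zero => simp [sigmaB]
  | succ p ih => rw [sigmaB_succ, ih, chi, coordB_todaFlow]; ring

lemma hasFDerivAt_sigmaB (n : ℕ) (x : TodaSpace N) :
    ∃ f : TodaSpace N →L[ℝ] ℝ, HasFDerivAt (fun y => sigmaB y n) f x ∧
      ∀ v, f v = sigmaB v n := by
  choose f hf hfv using fun i => hasFDerivAt_coordB (N := N) i x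
  exact ⟨_, HasFDerivAt.fun_sum fun i _ => hf i, fun v => by simp [hfv, sigmaB]⟩

lemma laxOne_compat (x : TodaSpace N) (m : ℕ) :
    skewPart (laxOne N x * jacobiMatrix x ^ m - jacobiMatrix x ^ m * laxOne N x)
      + (skewPart (jacobiMatrix x ^ m) * laxOne N x - laxOne N x * skewPart (jacobiMatrix x ^ m))
      = matDeriv (laxOne N) x (chi N m x) := by
  unfold laxOne
  rw [matDeriv_skewBand (fun n => contDiff_const.mul (contDiff_coordA n))
    (fun _ => contDiff_const)]
  refine skewPart_commutator_skewBand (jacobiMatrix_pow_transpose x m) (fun p _ => ?_)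
    (fun p _ => by simp)
  obtain ⟨f, hf, hfv⟩ := hasFDerivAt_coordA (p + 1) x
  rw [(hf.const_mul _).fderiv, smul_apply, hfv, chi, coordA_todaFlow, smul_eq_mul]
  ring

/-- This is where σₙ is needed in B: differentiating n(bₙ + bₙ₊₁) alone gives a_{n-1}aₙ the weight
n, and the derivative of σₙ lowers it to n − 1, the weight in B_{n-1,n+1}. -/
lemma laxTwo_compat (x : TodaSpace N) (m : ℕ) :
    skewPart (laxTwo N x * jacobiMatrix x ^ m - jacobiMatrix x ^ m * laxTwo N x)
      + (skewPart (jacobiMatrix x ^ m) * laxTwo N x - laxTwo N x * skewPart (jacobiMatrix x ^ m))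
      = matDeriv (laxTwo N) x (chi N m x) := by
  unfold laxTwo
  rw [matDeriv_skewBand contDiff_laxTwo_upper contDiff_laxTwo_second]
  refine skewPart_commutator_skewBand (jacobiMatrix_pow_transpose x m) (fun p _ => ?_)
    (fun p _ => ?_)
  · obtain ⟨f, hf, hfv⟩ := hasFDerivAt_coordA (p + 1) x
    obtain ⟨g, hg, hgv⟩ := hasFDerivAt_coordB (p + 1) x
    obtain ⟨h, hh, hhv⟩ := hasFDerivAt_coordB (p + 1 + 1) x
    obtain ⟨s, hs, hsv⟩ := hasFDerivAt_sigmaB (p + 1) x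
    rw [(hf.fun_mul (((hg.fun_add hh).const_mul _).fun_add hs)).fderiv]
    simp only [add_apply, smul_apply, smul_eq_mul, hfv, hgv, hhv, hsv, sigmaB_chi]
    simp only [chi, coordA_todaFlow, coordB_todaFlow]
    push_cast
    ring
  · obtain ⟨f, hf, hfv⟩ := hasFDerivAt_coordA (p + 1) x
    obtain ⟨g, hg, hgv⟩ := hasFDerivAt_coordA (p + 1 + 1) x
    rw [((hf.const_mul _).fun_mul hg).fderiv]
    simp only [add_apply, smul_apply, smul_eq_mul, hfv, hgv]
    simp only [chi, coordA_todaFlow]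
    ring

/-- `X_k H_l = (l + k) H_{l+k}`. -/
lemma fderiv_todaH_masterSymmetry (k m : ℕ) (x : TodaSpace N) :
    fderiv ℝ (todaH N (m + 1)) x (masterSymmetry N (k + 1) x) =
      ((m : ℝ) + k + 2) * todaH N (m + k + 2) x := by
  induction k using Nat.twoStepInduction generalizing m x with
  | zero =>
    have := fderiv_todaH_of_lax (k := 1) (jacobiMatrix_masterOne x) m
    rw [masterSymmetry, this]
    push_cast
    ring
  | one =>
    have := fderiv_todaH_of_lax (k := 2) (jacobiMatrix_masterTwo x) m
    rw [masterSymmetry, this]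
    push_cast
    ring
  | more k _ ih =>
    have hone : ∀ m x, fderiv ℝ (todaH N (m + 1)) x (masterOne N x) =
        ((m : ℝ) + 2) * todaH N (m + 2) x := by
      intro m x
      rw [fderiv_todaH_of_lax (k := 1) (jacobiMatrix_masterOne x) m]
      push_cast
      ring
    have hH := fun l => (contDiff_todaH (N := N) l).differentiableAt_of_infty x
    rw [masterSymmetry, Pi.smul_apply, map_smul, VectorField.fderiv_apply_lieBracket
      (contDiff_todaH (m + 1)).contDiffAt minSmoothness_two_le_infty
      ((contDiff_masterSymmetry _).differentiableAt_of_infty x)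
      (contDiff_masterOne.differentiableAt_of_infty x)]
    -- The coefficients combine as (m + k + 4)((m + k + 3) − (m + 2)) = (k + 1)(m + k + 4), and k +
    -- 1 is the normalising factor of X_{k+3}.
    simp only [ih, hone]
    rw [fderiv_const_mul (hH _), fderiv_const_mul (hH _), smul_apply, smul_apply,
      hone (m + (k + 1) + 1), ih (m + 1),
      show m + 1 + (k + 1) + 2 = m + (k + 1) + 1 + 2 by ring,
      show m + (k + 1 + 1) + 2 = m + (k + 1) + 1 + 2 by ring]
    push_cast
    simp only [smul_eq_mul]
    field_simp
    ring

/-- `[X_k, χ_j] = (j - 1) χ_{j+k}`. -/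
lemma lieBracket_masterSymmetry_chi (k m : ℕ) (x : TodaSpace N) :
    VectorField.lieBracket ℝ (masterSymmetry N (k + 1)) (chi N m) x =
      (m : ℝ) • chi N (m + k + 1) x := by
  have hone := lieBracket_chi_of_lax (N := N) (k := 1) contDiff_masterOne matSmooth_laxOne
    jacobiMatrix_masterOne laxOne_compat
  induction k using Nat.twoStepInduction generalizing m x with
  | zero => exact hone m x
  | one =>
    exact lieBracket_chi_of_lax (k := 2) contDiff_masterTwo matSmooth_laxTwo
      jacobiMatrix_masterTwo laxTwo_compat m x
  | more k _ ih =>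
    have hX := contDiff_masterSymmetry (N := N) (k + 2)
    -- The Jacobi identity for X₁, X_{k+2} and χ gives the coefficient m(m + k + 2) − m(m + 1) = m(k
    -- + 1).
    have hj := VectorField.leibniz_identity_lieBracket minSmoothness_two_le_infty
      (contDiff_masterOne.contDiffAt (x := x)) hX.contDiffAt (contDiff_chi m).contDiffAt
    have e1 : VectorField.lieBracket ℝ (masterSymmetry N (k + 2)) (chi N m) =
        (m : ℝ) • chi N (m + (k + 1) + 1) := by
      ext1 y; exact ih m y
    have e2 : VectorField.lieBracket ℝ (masterOne N) (chi N m) = (m : ℝ) • chi N (m + 1) := by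
      ext1 y; exact hone m y
    have hc := fun m => (contDiff_chi (N := N) m).differentiableAt_of_infty x
    rw [e1, e2, VectorField.lieBracket_const_smul_right (hc _),
      VectorField.lieBracket_const_smul_right (hc _), hone, ih (m + 1)] at hj
    rw [masterSymmetry, VectorField.lieBracket_const_smul_left
      ((contDiff_masterOne.lieBracket_vectorField hX (m := ∞) (by simp)).differentiableAt_of_infty x),
      ← sub_eq_iff_eq_add.2 hj, show m + 1 + (k + 1) + 1 = m + (k + 1) + 1 + 1 by ring,
      show m + (k + 1 + 1) + 1 = m + (k + 1) + 1 + 1 by ring, smul_smul, smul_smul, ← sub_smul,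
      smul_smul]
    congr 1
    push_cast
    field_simp
    ring

/-! ### Induction along the hierarchy, and existence. -/

lemma hamiltonianField_const_mul (P : TodaTensor N) {f : TodaSpace N → ℝ}
    (hf : ContDiff ℝ ∞ f) (c : ℝ) (x : TodaSpace N) :
    hamiltonianField P (fun y => c * f y) x = c • hamiltonianField P f x := by
  have : coordGrad (fun y => c * f y) x = c • coordGrad f x := by
    ext i
    simp only [coordGrad, Pi.smul_apply]
    rw [fderiv_const_mul (hf.differentiableAt_of_infty x)]
    rfl
  rw [hamiltonianField, this, Matrix.mulVec_smul]
  rfl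

/-- In the Leibniz rule the bracket contributes m + s and the differentiated Hamiltonian m + k + 2,
both on the same flow; the m cancels. -/
lemma hamiltonianField_lieDerivTensor_masterSymmetry {P : TodaTensor N}
    (hP : ∀ i j, ContDiff ℝ ∞ (fun x => P x i j)) {s : ℕ}
    (h : ∀ m, hamiltonianField P (todaH N (m + 1)) = chi N (m + s)) (k m : ℕ) (x : TodaSpace N) :
    hamiltonianField (lieDerivTensor (masterSymmetry N (k + 1)) P) (todaH N (m + 1)) x =
      ((s : ℝ) - k - 2) • chi N (m + k + 1 + s) x := by
  have e : (fun y => fderiv ℝ (todaH N (m + 1)) y (masterSymmetry N (k + 1) y)) =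
      fun y => ((m : ℝ) + k + 2) * todaH N (m + k + 1 + 1) y := by
    ext y; exact fderiv_todaH_masterSymmetry k m y
  rw [hamiltonianField_lieDerivTensor (contDiff_masterSymmetry _) hP (contDiff_todaH _), e,
    hamiltonianField_const_mul P (contDiff_todaH _), h, h, lieBracket_masterSymmetry_chi,
    show m + s + k + 1 = m + k + 1 + s by ring, ← sub_smul]
  congr 1
  push_cast
  ring

/-- The induction is strong because the generating tensor may be any earlier one. Knowing `π n` up
to equivalence suffices, since only its action on the ∇H_l enters. -/
lemma IsTodaHierarchy.hamiltonianField_eq_chi {π : ℕ → TodaTensor N} (hπ : IsTodaHierarchy N π)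
    (n m : ℕ) : hamiltonianField (π (n + 1)) (todaH N (m + 1)) = chi N (m + n) := by
  induction n using Nat.strong_induction_on generalizing m with
  | _ n ih =>
  match n with
  | 0 => rw [hπ.one]; exact hamiltonianField_linearToda m
  | 1 => rw [hπ.two]; exact hamiltonianField_quadraticToda m
  | 2 => rw [hπ.three]; exact hamiltonianField_cubicToda m
  | n + 3 =>
    obtain ⟨k, s, hk, hs, hks, hne, hequiv⟩ := hπ.generated (n + 3 + 1) (by omega)
    obtain ⟨k, rfl⟩ := Nat.exists_eq_add_of_le' hk
    obtain ⟨s, rfl⟩ := Nat.exists_eq_add_of_le' hs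
    ext1 x
    have h := hequiv (m + 1) (by omega) x
    have hlie := hamiltonianField_lieDerivTensor_masterSymmetry (hπ.smooth (s + 1) hs)
      (ih s (by omega)) k m x
    rw [hamiltonianField] at h hlie
    rw [Pi.sub_apply, Matrix.sub_mulVec, hlie, Pi.smul_apply, Matrix.smul_mulVec, sub_eq_zero] at h
    have hc : (((s + 1 : ℕ) : ℝ) - (k + 1 : ℕ) - 2) ≠ 0 := by
      intro h0
      apply hne
      have : ((s + 1 : ℕ) : ℝ) = ((k + 1 + 2 : ℕ) : ℝ) := by push_cast at h0 ⊢; linarith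
      exact_mod_cast this
    rw [show m + k + 1 + s = m + (n + 3) by omega] at h
    have h' : (((s + 1 : ℕ) : ℝ) - (k + 1 : ℕ) - 2) • chi N (m + (n + 3)) x =
        (((s + 1 : ℕ) : ℝ) - (k + 1 : ℕ) - 2) •
          hamiltonianField (π (n + 3 + 1)) (todaH N (m + 1)) x := by
      rw [hamiltonianField, ← h]
      congr 1
      push_cast
      ring
    exact (smul_right_injective _ hc h').symm

/-- The hierarchy in which `πₙ`, `n ≥ 4`, is generated from `π₁` by `X_{n-1}`. -/
def generatedToda (N : ℕ) : ℕ → TodaTensor N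
  | 0 => 0
  | 1 => linearToda N
  | 2 => quadraticToda N
  | 3 => cubicToda N
  | n + 4 => (-(1 / ((n : ℝ) + 4))) • lieDerivTensor (masterSymmetry N (n + 3)) (linearToda N)

lemma isTodaHierarchy_generatedToda (N : ℕ) : IsTodaHierarchy N (generatedToda N) where
  smooth
    | 1, _, i, j => contDiff_linearToda i j
    | 2, _, i, j => contDiff_quadraticToda i j
    | 3, _, i, j => contDiff_cubicToda i j
    | n + 4, _, i, j => contDiff_const.mul
        (contDiff_lieDerivTensor (contDiff_masterSymmetry (n + 3)) contDiff_linearToda i j)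
  skew
    | 1, _, x => linearToda_transpose x
    | 2, _, x => quadraticToda_transpose x
    | 3, _, x => cubicToda_transpose x
    | n + 4, _, x => by
        rw [generatedToda, Pi.smul_apply, Matrix.transpose_smul,
          lieDerivTensor_transpose _ linearToda_transpose, smul_neg]
  one := rfl
  two := rfl
  three := rfl
  generated n hn := by
    obtain ⟨n, rfl⟩ := Nat.exists_eq_add_of_le' hn
    -- Generating from π₁ gives the factor 1 − (n + 3) − 2 = −(n + 4), which never vanishes; the
    -- equivalence is then an equality of tensors.
    refine ⟨n + 3, 1, by omega, le_rfl, by omega, by omega, fun l _ x => ?_⟩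
    have e : (((1 : ℕ) : ℝ) - ((n + 3 : ℕ) : ℝ) - 2) • generatedToda N (n + 4) =
        lieDerivTensor (masterSymmetry N (n + 3)) (linearToda N) := by
      rw [generatedToda, smul_smul]
      have : (n : ℝ) + 4 ≠ 0 := by positivity
      rw [show (((1 : ℕ) : ℝ) - ((n + 3 : ℕ) : ℝ) - 2) * -(1 / ((n : ℝ) + 4)) = 1 by
        push_cast; field_simp; ring, one_smul]
    rw [e]
    simp [hamiltonianField, generatedToda]

end Hierarchy

end

/-- Toda hierarchies exist, and in each of them the Lenard relations
`χ_l^{n+1} = χ_{l+1}^n`, where `χ_l^n = πₙ ∇H_l`, hold for all `n, l ≥ 1`. -/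
theorem proposition2 (N : ℕ) :
    (∃ π : ℕ → TodaTensor N, IsTodaHierarchy N π) ∧
    ∀ π : ℕ → TodaTensor N, IsTodaHierarchy N π →
      ∀ n l : ℕ, 1 ≤ n → 1 ≤ l →
        hamiltonianField (π (n + 1)) (todaH N l) = hamiltonianField (π n) (todaH N (l + 1)) := by
  refine ⟨⟨generatedToda N, isTodaHierarchy_generatedToda N⟩, fun π hπ n l hn hl => ?_⟩
  obtain ⟨n, rfl⟩ := Nat.exists_eq_add_of_le' hn
  obtain ⟨l, rfl⟩ := Nat.exists_eq_add_of_le' hl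
  rw [hπ.hamiltonianField_eq_chi, hπ.hamiltonianField_eq_chi, add_right_comm, add_assoc]
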